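/- Let $\sigma>0$, let $U_0,U_1,\dots$ be independent bits, uniformly distributed on $\{0,1\}$, and let $N_1,N_2,\dots$ be independent $\mathcal N(0,\sigma^2)$ random variables, the sequence $(N_k)$ being independent of the sequence $(U_k)$. Put $X_0=0$ and, for $k\ge 1$, $X_k=X_{k-1}+U_{k-1}$ and $Y_k=X_k+N_k$. The One State decoder produces estimates $\widehat U_{k}\in\{0,1\}$ recursively: $\widehat X_0=0$ and, for $k\ge 1$, with $$\Gamma_k(i,j)=\frac{1}{2\sigma\sqrt{2\pi}}\exp\Big(-\frac{(Y_k-j)^2}{2\sigma^2}\Big)\qquad(j\in\{i,i+1\}),$$ $\widehat U_{k-1}=0$ if $\Gamma_k(\widehat X_{k-1},\widehat X_{k-1})\ge \Gamma_k(\widehat X_{k-1},\widehat X_{k-1}+1)$, $\widehat U_{k-1}=1$ otherwise, and $\widehat X_k=\widehat X_{k-1}+\widehat U_{k-1}$. For $K\ge1$ and $u\in\{0,1\}^{\mathbb N}$ let $$P_b^{(K)}(e)=\frac1K\sum_{k=0}^{K-1}\mathbb P(\widehat U_k\ne U_k),\qquad P_b^{(K)}(e\mid u)=\frac1K\sum_{k=0}^{K-1}\mathbb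 P\big(\widehat U_k\ne U_k\,\big|\,U_0=u_0,\dots,U_{K-1}=u_{K-1}\big)$$ be the bit error rate and the conditional bit error rate. With $\operatorname{erfc}(z)=\frac{2}{\sqrt\pi}\int_z^\infty e^{-t^2}\,dt$, define matrices $\mathbf P(0),\mathbf P(1)$ on $\mathbb Z$ whose only non-zero entries are $$\mathbf P_{d,d+1}(0)=\tfrac12\operatorname{erfc}\Big(\frac{d+\frac12}{\sqrt2\,\sigma}\Big),\quad \mathbf P_{d,d}(0)=1-\mathbf P_{d,d+1}(0),\quad \mathbf P_{d,d}(1)=\tfrac12\operatorname{erfc}\Big(\frac{d-\frac12}{\sqrt2\,\sigma}\Big),\quad \mathbf P_{d,d-1}(1)=1-\mathbf P_{d,d}(1)$$ for $d\in\mathbb Z$, and put $\overline{\mathbf P}=\frac12(\mathbf P(0)+\mathbf P(1))$ and $\overline{\mathrm q}_d=\overline{\mathbf P}_{d,d+1}+\overline{\mathbf P}_{d,d-1}$. Then $\overline{\mathbf P}$ has a unique invariant probability vector $\Phi=(\Phi_d)_{d\in\mathbb Z}$, the series $\sum_{d\in\mathbb Z}\overline{\mathrm q}_d\Phi_d$ converges,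 and, for almost every $u$ with respect to the uniform Bernoulli measure $\pi$ on $\{0,1\}^{\mathbb N}$, $$\lim_{K\to\infty}P_b^{(K)}(e\mid u)=\lim_{K\to\infty}P_b^{(K)}(e)=\sum_{d\in\mathbb Z}\overline{\mathrm q}_d\,\Phi_d ,$$ both limits existing. -/

import Mathlib

open MeasureTheory ProbabilityTheory Filter Topology
open scoped NNReal

noncomputable section

namespace OneState

/-! ### The transmission system (sampling time `τ = 1`, bits `false = 0`, `true = 1`) -/

/-- The state `x_k` of the encoder: `x_0 = 0`, `x_{k+1} = x_k + u_k`. -/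
def state (u : ℕ → Bool) : ℕ → ℕ
  | 0 => 0
  | k + 1 => state u k + (u k).toNat

/-- The received symbols. Measurements start at time `1`, so the sequence is indexed from the
first one: entry `k` is `y_{k+1} = x_{k+1} + n_{k+1}`, and `n k` stands for the noise `n_{k+1}`. -/
def received (u : ℕ → Bool) (n : ℕ → ℝ) (k : ℕ) : ℝ := (state u (k + 1) : ℝ) + n k

/-! ### The One State decoder -/

/-- The transition weight `Γ(i, j)` for the received symbol `y`: the Gaussian density of `y` given
the new state `j`, times the probability (`1/2` if `j = i` or `j = i + 1`, else `0`) of moving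
from the state `i` to the state `j`. -/
def Gam (σ : ℝ≥0) (y : ℝ) (i j : ℕ) : ℝ :=
  gaussianPDFReal (j : ℝ) (σ ^ 2) y * (if j = i ∨ j = i + 1 then 1 / 2 else 0)

/-- The decision on the current bit, given the current estimated state `i` and the received
symbol `y`. -/
def bitDecision (σ : ℝ≥0) (i : ℕ) (y : ℝ) : Bool :=
  if Gam σ y i i ≥ Gam σ y i (i + 1) then false else true

/-- The estimated state: `x̂_0 = 0`, `x̂_{k+1} = x̂_k + û_k`. It depends on the first `k` received
symbols only. -/
def estState (σ : ℝ≥0) (y : ℕ → ℝ) : ℕ → ℕ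
  | 0 => 0
  | k + 1 => estState σ y k + (bitDecision σ (estState σ y k) (y k)).toNat

/-- The bit `û_k` estimated by the One State decoder. It depends on the first `k + 1` received
symbols only, so the decoder of a message of length `K` is the restriction to `k < K`. -/
def decoder (σ : ℝ≥0) (y : ℕ → ℝ) (k : ℕ) : Bool := bitDecision σ (estState σ y k) (y k)

/-! ### Bit error rates -/

section Rates

variable {Ω : Type*} [MeasurableSpace Ω]

/-- The event `Û_k ≠ U_k`. -/
def errorEvent (σ : ℝ≥0) (U : ℕ → Ω → Bool) (N : ℕ → Ω → ℝ) (k : ℕ) : Set Ω :=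
  {ω | decoder σ (received (fun j => U j ω) (fun j => N j ω)) k ≠ U k ω}

/-- The bit error rate of a message of length `K`. -/
def BER (P : Measure Ω) (σ : ℝ≥0) (U : ℕ → Ω → Bool) (N : ℕ → Ω → ℝ) (K : ℕ) : ℝ :=
  1 / (K : ℝ) * ∑ k ∈ Finset.range K, P.real (errorEvent σ U N k)

/-- The conditional bit error rate of a message of length `K`, given that the transmitted bits
`U_0, …, U_{K-1}` are `u_0, …, u_{K-1}`. -/
def CBER (P : Measure Ω) (σ : ℝ≥0) (U : ℕ → Ω → Bool) (N : ℕ → Ω → ℝ) (u : ℕ → Bool)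
    (K : ℕ) : ℝ :=
  1 / (K : ℝ) * ∑ k ∈ Finset.range K,
    (ProbabilityTheory.cond P {ω | ∀ j < K, U j ω = u j}).real (errorEvent σ U N k)

end Rates

/-! ### The chain `D_k = X̂_k - X_k` -/

/-- The complementary error function. -/
def erfc (z : ℝ) : ℝ := 2 / Real.sqrt Real.pi * ∫ t in Set.Ioi z, Real.exp (-t ^ 2)

/-- The transition probability from `d` to `e` of the difference between estimated and actual
state, when the transmitted bit is `0` (`false`) or `1` (`true`). -/
def trans (σ : ℝ≥0) : Bool → ℤ → ℤ → ℝ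
  | false, d, e =>
      if e = d + 1 then 1 / 2 * erfc (((d : ℝ) + 1 / 2) / (Real.sqrt 2 * σ))
      else if e = d then 1 - 1 / 2 * erfc (((d : ℝ) + 1 / 2) / (Real.sqrt 2 * σ))
      else 0
  | true, d, e =>
      if e = d then 1 / 2 * erfc (((d : ℝ) - 1 / 2) / (Real.sqrt 2 * σ))
      else if e = d - 1 then 1 - 1 / 2 * erfc (((d : ℝ) - 1 / 2) / (Real.sqrt 2 * σ))
      else 0

/-- The transition probability from `d` to `e` under a uniform input bit. -/
def avgTrans (σ : ℝ≥0) (d e : ℤ) : ℝ := 1 / 2 * (trans σ false d e + trans σ true d e)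

/-- The error probability `q̄_d` of the current bit when the difference is `d`. -/
def qbar (σ : ℝ≥0) (d : ℤ) : ℝ := avgTrans σ d (d + 1) + avgTrans σ d (d - 1)

/-- `Φ` is an invariant probability vector of the matrix `Q` on `ℤ`. -/
def IsInvariantProb (Q : ℤ → ℤ → ℝ) (Φ : ℤ → ℝ) : Prop :=
  (∀ d, 0 ≤ Φ d) ∧ HasSum Φ 1 ∧ ∀ e, HasSum (fun d => Φ d * Q d e) (Φ e)

/-! ### The uniform Bernoulli measure -/

/-- The law of a fair bit. -/
def fairBit : Measure Bool := (PMF.uniformOfFintype Bool).toMeasure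

instance : IsProbabilityMeasure fairBit := by
  unfold fairBit
  infer_instance

/-- The uniform Bernoulli measure on sequences of bits. -/
def bernoulliMeasure : Measure (ℕ → Bool) := Measure.infinitePi (fun _ => fairBit)

end OneState

end

/-!
The difference `D_k = X̂_k - X_k` is a Markov chain on `ℤ` with steps in `{-1, 0, 1}`, and bit
`k` is decoded wrongly exactly when `D_{k+1} ≠ D_k`. All transition probabilities come from
the single sequence `a d = ℙ(N > d + 1/2)` (`tail`), which is decreasing, satisfies `a (-1 - d) =
1 - a d` and has `a 0 < 1/2` (`IsCrossing`).

Under uniform bits the chain is tridiagonal, so an invariant probability vector has zero net flow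
between neighbours: `Φ d * a d = Φ (d + 1) * (1 - a d)`. This determines `Φ` up to a factor, and
the solution is summable because `a d / (1 - a d) ≤ a 0 / (1 - a 0) < 1` for `d ≥ 0`
(`isInvariantProb_stationary`, `eq_stationary_of_isInvariantProb`).

For a fixed bit sequence `u`, let `E_k^u f` be the mean of `f (D_k)` over the noise (`quenched`).
The Poisson equation `(1 - P̄) g = q̄ - c`, with `c = ∑ q̄ Φ`, has a solution `g` with bounded
increments, as its increments are tails of `∑ Φ (c - q̄)` divided by `Φ d * a d / 2`, and these
tails are at most a constant times their largest term (`abs_poissonStep_le`). Adding the change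
of `g` to the centred error probability gives corrected errors `W_k u`, which are bounded, depend
on `u_0, …, u_k` only, and change sign when `u_k` is inverted. As inverting a bit preserves the
Bernoulli measure, the `W_k` are orthogonal and their partial sums have second moments `O(K)`
(`integral_corrSum_sq_le`). The boundary term `E_K^u g` also has second moment `O(K)`: `g` has
linear growth, and the drift of the chain towards `0` keeps the mean of `D_K ^ 2` at most `K`
(`integral_quenched_sq_le`). A sequence of partial sums with bounded increments and second
moments `O(K)` is `o(K)` almost everywhere (`ae_tendsto_div_of_integral_sq_le`), which gives the
ergodic theorem `ae_tendsto_quenched_errProb` for almost every `u`.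

Finally, as `D_k` depends on the noise before time `k` only, `E_k^u` yields the conditional error
probabilities given the bits (`CBER_eq`), and the bit error rate is the mean over `u` of the
conditional one (`BER_eq_integral`), so that its limit follows by dominated convergence.
-/

noncomputable section

namespace OneState

/-! ### The crossing probabilities -/

/-- The probability that Gaussian noise of standard deviation `σ` exceeds `d + 1/2`. It is the
probability that a zero bit moves the difference from `d` to `d + 1`, and that a one bit moves it
from `d + 1` to itself. -/
def tail (σ : ℝ≥0) (d : ℤ) : ℝ := (gaussianReal 0 (σ ^ 2)).real (Set.Ioi ((d : ℝ) + 1 / 2))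

/-- The properties of the sequence of crossing probabilities on which the analysis of the chain
rests. -/
structure IsCrossing (a : ℤ → ℝ) : Prop where
  pos : ∀ d, 0 < a d
  antitone : Antitone a
  reflect : ∀ d, a (-1 - d) = 1 - a d
  zero_lt_half : a 0 < 1 / 2

lemma IsCrossing.lt_one {a : ℤ → ℝ} (h : IsCrossing a) (d : ℤ) : a d < 1 := by
  have := h.reflect d
  have := h.pos (-1 - d)
  linarith

lemma half_erfc_eq {σ : ℝ≥0} (hσ : 0 < σ) (x : ℝ) :
    1 / 2 * erfc (x / (Real.sqrt 2 * σ)) = (gaussianReal 0 (σ ^ 2)).real (Set.Ioi x) := by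
  have hσ' : (0 : ℝ) < σ := by exact_mod_cast hσ
  have hb : (0 : ℝ) < (Real.sqrt 2 * σ)⁻¹ := by positivity
  have hv : σ ^ 2 ≠ 0 := by positivity
  have h1 := integral_comp_mul_left_Ioi (fun t => Real.exp (-t ^ 2)) x hb
  have h2 : (Real.sqrt 2 * σ)⁻¹ * x = x / (Real.sqrt 2 * σ) := by ring
  rw [h2, inv_inv, smul_eq_mul] at h1
  rw [Measure.real, gaussianReal_apply_eq_integral _ hv, ENNReal.toReal_ofReal
    (integral_nonneg fun _ => gaussianPDFReal_nonneg _ _ _)]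
  have h3 : ∀ t : ℝ, gaussianPDFReal 0 (σ ^ 2) t
      = (Real.sqrt (2 * Real.pi * (σ : ℝ) ^ 2))⁻¹
        * Real.exp (-((Real.sqrt 2 * σ)⁻¹ * t) ^ 2) := by
    intro t
    rw [gaussianPDFReal]
    push_cast
    congr 2
    rw [mul_pow, inv_pow, mul_pow, Real.sq_sqrt (by norm_num)]
    ring
  simp_rw [h3]
  rw [integral_const_mul, h1, erfc, Real.sqrt_mul (by positivity), Real.sqrt_mul (by positivity),
    Real.sqrt_sq hσ'.le]
  field_simp

lemma gaussianReal_real_Ioi_lt {v : ℝ≥0} (hv : v ≠ 0) {x y : ℝ} (hxy : x < y) :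
    (gaussianReal 0 v).real (Set.Ioi y) < (gaussianReal 0 v).real (Set.Ioi x) := by
  rw [← Set.Ioc_union_Ioi_eq_Ioi hxy.le,
    measureReal_union (Set.Ioc_disjoint_Ioi le_rfl) measurableSet_Ioi]
  have : 0 < (gaussianReal 0 v).real (Set.Ioc x y) := by
    rw [measureReal_def, ENNReal.toReal_pos_iff]
    refine ⟨pos_iff_ne_zero.2 fun h => ?_, measure_lt_top _ _⟩
    have := gaussianReal_absolutelyContinuous' 0 hv h
    simp at this
    linarith
  linarith

lemma gaussianReal_real_Ioi_neg {v : ℝ≥0} (hv : v ≠ 0) (x : ℝ) :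
    (gaussianReal 0 v).real (Set.Ioi (-x)) = 1 - (gaussianReal 0 v).real (Set.Ioi x) := by
  have := nullSingletonClass_gaussianReal (μ := 0) hv
  have h1 : (gaussianReal 0 v).real (Set.Ioi (-x)) = (gaussianReal 0 v).real (Set.Iio x) := by
    conv_lhs => rw [← neg_zero, ← gaussianReal_map_neg]
    rw [map_measureReal_apply measurable_neg measurableSet_Ioi]
    congr 1
    ext t
    simp
  rw [h1, measureReal_congr Iio_ae_eq_Iic, ← probReal_compl_eq_one_sub measurableSet_Ioi,
    Set.compl_Ioi]

lemma isCrossing_tail {σ : ℝ≥0} (hσ : 0 < σ) : IsCrossing (tail σ) := by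
  have hv : σ ^ 2 ≠ 0 := by positivity
  refine ⟨fun d => ?_, fun d e hde => ?_, fun d => ?_, ?_⟩
  · exact measureReal_nonneg.trans_lt (gaussianReal_real_Ioi_lt hv (lt_add_one _))
  · exact measureReal_mono (Set.Ioi_subset_Ioi (by gcongr))
  · rw [tail, tail, ← gaussianReal_real_Ioi_neg hv]
    congr 2
    push_cast
    ring
  · have h0 := gaussianReal_real_Ioi_neg hv 0
    rw [neg_zero] at h0
    have := gaussianReal_real_Ioi_lt hv (show (0 : ℝ) < (0 : ℤ) + 1 / 2 by norm_num)
    rw [tail]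
    linarith

/-! ### The averaged transition matrix -/

/-- The transition matrix of the difference chain under uniform bits, expressed through the
crossing probabilities: it is tridiagonal. -/
def chainMatrix (a : ℤ → ℝ) (d e : ℤ) : ℝ :=
  if e = d + 1 then a d / 2 else if e = d - 1 then (1 - a (d - 1)) / 2
  else if e = d then (1 - a d + a (d - 1)) / 2 else 0

/-- The probability of a decoding error when the bit is `b` and the difference is `d`. -/
def errProb (a : ℤ → ℝ) : Bool → ℤ → ℝ
  | false, d => a d
  | true, d => 1 - a (d - 1)

/-- The error probability averaged over a uniform bit. -/
def meanErr (a : ℤ → ℝ) (d : ℤ) : ℝ := (a d + (1 - a (d - 1))) / 2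

lemma avgTrans_eq {σ : ℝ≥0} (hσ : 0 < σ) : avgTrans σ = chainMatrix (tail σ) := by
  have h1 (d : ℤ) : 1 / 2 * erfc (((d : ℝ) + 1 / 2) / (Real.sqrt 2 * σ)) = tail σ d :=
    half_erfc_eq hσ _
  have h2 (d : ℤ) : 1 / 2 * erfc (((d : ℝ) - 1 / 2) / (Real.sqrt 2 * σ)) = tail σ (d - 1) := by
    rw [half_erfc_eq hσ, tail]
    congr 2
    push_cast
    ring
  ext d e
  rw [avgTrans, trans, trans, h1, h2, chainMatrix]
  split_ifs <;> first | omega | ring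

lemma qbar_eq {σ : ℝ≥0} (hσ : 0 < σ) : qbar σ = meanErr (tail σ) := by
  ext d
  rw [qbar, avgTrans_eq hσ, chainMatrix, chainMatrix, meanErr]
  rw [if_pos rfl, if_neg (by omega), if_pos rfl]
  ring

/-! ### The invariant probability vector -/

/-- The reversible weights of the chain: `weight a 0 = 1`, and the weights are even in `d`. -/
def weight (a : ℤ → ℝ) (d : ℤ) : ℝ := ∏ i ∈ Finset.range d.natAbs, a i / (1 - a i)

lemma weight_pos {a : ℤ → ℝ} (h : IsCrossing a) (d : ℤ) : 0 < weight a d :=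
  Finset.prod_pos fun i _ => div_pos (h.pos i) (sub_pos.2 (h.lt_one i))

lemma weight_balance {a : ℤ → ℝ} (h : IsCrossing a) (d : ℤ) :
    weight a d * a d = weight a (d + 1) * (1 - a d) := by
  obtain ⟨n, rfl | rfl⟩ : ∃ n : ℕ, d = n ∨ d = -1 - n := by
    rcases le_or_gt 0 d with hd | hd
    · exact ⟨d.toNat, Or.inl (by omega)⟩
    · exact ⟨(-1 - d).toNat, Or.inr (by omega)⟩
  · have h1 : ((n : ℤ) + 1).natAbs = n + 1 := by omega
    have := sub_pos.2 (h.lt_one n)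
    rw [weight, weight, h1, Int.natAbs_natCast, Finset.prod_range_succ]
    field_simp
  · have h1 : (-1 - (n : ℤ)).natAbs = n + 1 := by omega
    have h2 : (-1 - (n : ℤ) + 1).natAbs = n := by omega
    have := sub_pos.2 (h.lt_one n)
    rw [weight, weight, h1, h2, Finset.prod_range_succ, h.reflect]
    field_simp
    ring

lemma weight_le_pow {a : ℤ → ℝ} (h : IsCrossing a) (d : ℤ) :
    weight a d ≤ (a 0 / (1 - a 0)) ^ d.natAbs := by
  rw [weight, ← Finset.card_range d.natAbs, ← Finset.prod_const, Finset.card_range]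
  refine Finset.prod_le_prod (fun i _ => (div_pos (h.pos i) (sub_pos.2 (h.lt_one i))).le)
    fun i _ => ?_
  have := h.antitone (show (0 : ℤ) ≤ i by omega)
  have := h.pos i
  have := h.lt_one 0
  exact div_le_div₀ (h.pos 0).le (by linarith) (by linarith) (by linarith)

lemma summable_weight {a : ℤ → ℝ} (h : IsCrossing a) : Summable (weight a) := by
  have hr : a 0 / (1 - a 0) < 1 := by
    have := h.zero_lt_half
    rw [div_lt_one] <;> linarith
  have hr0 : 0 ≤ a 0 / (1 - a 0) := (div_pos (h.pos 0) (sub_pos.2 (h.lt_one 0))).le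
  refine Summable.of_nonneg_of_le (fun d => (weight_pos h d).le) (weight_le_pow h) ?_
  refine summable_int_iff_summable_nat_and_neg.2 ⟨?_, ?_⟩ <;>
    simpa using summable_geometric_of_lt_one hr0 hr

/-- The invariant probability vector of the difference chain. -/
def stationary (a : ℤ → ℝ) (d : ℤ) : ℝ := weight a d / ∑' e, weight a e

lemma tsum_weight_pos {a : ℤ → ℝ} (h : IsCrossing a) : 0 < ∑' e, weight a e :=
  (summable_weight h).tsum_pos (fun d => (weight_pos h d).le) 0 (weight_pos h 0)

lemma stationary_pos {a : ℤ → ℝ} (h : IsCrossing a) (d : ℤ) : 0 < stationary a d :=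
  div_pos (weight_pos h d) (tsum_weight_pos h)

lemma hasSum_stationary {a : ℤ → ℝ} (h : IsCrossing a) : HasSum (stationary a) 1 := by
  have := (summable_weight h).hasSum.div_const (∑' e, weight a e)
  rwa [div_self (tsum_weight_pos h).ne'] at this

lemma stationary_balance {a : ℤ → ℝ} (h : IsCrossing a) (d : ℤ) :
    stationary a d * a d = stationary a (d + 1) * (1 - a d) := by
  rw [stationary, stationary, div_mul_eq_mul_div, div_mul_eq_mul_div, weight_balance h]

lemma hasSum_mul_chainMatrix (a Ψ : ℤ → ℝ) (e : ℤ) :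
    HasSum (fun d => Ψ d * chainMatrix a d e)
      (Ψ (e - 1) * (a (e - 1) / 2) + Ψ e * ((1 - a e + a (e - 1)) / 2)
        + Ψ (e + 1) * ((1 - a e) / 2)) := by
  have : HasSum (fun d => Ψ d * chainMatrix a d e)
      (∑ d ∈ {e - 1, e, e + 1}, Ψ d * chainMatrix a d e) :=
    hasSum_sum_of_ne_finset_zero fun d hd => by
      simp only [Finset.mem_insert, Finset.mem_singleton, not_or] at hd
      simp only [chainMatrix]
      rw [if_neg (by omega), if_neg (by omega), if_neg (by omega), mul_zero]
  rw [Finset.sum_insert (by simp; omega), Finset.sum_insert (by simp), Finset.sum_singleton] at this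
  convert! this using 1
  simp only [chainMatrix]
  rw [if_pos (by omega), if_neg (by omega), if_neg (by omega), if_pos (by trivial),
    if_neg (by omega), if_pos (by omega), add_sub_cancel_right]
  ring

lemma isInvariantProb_stationary {a : ℤ → ℝ} (h : IsCrossing a) :
    IsInvariantProb (chainMatrix a) (stationary a) := by
  refine ⟨fun d => (stationary_pos h d).le, hasSum_stationary h, fun e => ?_⟩
  convert! hasSum_mul_chainMatrix a (stationary a) e using 1
  have h1 := stationary_balance h e
  have h2 := stationary_balance h (e - 1)
  rw [sub_add_cancel] at h2
  linarith

/-- For an invariant vector of a tridiagonal matrix the net flow between `d` and `d + 1` does not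
depend on `d`; it vanishes because the vector is summable. -/
lemma IsInvariantProb.balance {a Ψ : ℤ → ℝ} (h : IsCrossing a)
    (hΨ : IsInvariantProb (chainMatrix a) Ψ) (d : ℤ) :
    Ψ d * a d = Ψ (d + 1) * (1 - a d) := by
  obtain ⟨h0, h1, h2⟩ := hΨ
  set F : ℤ → ℝ := fun d => Ψ d * a d - Ψ (d + 1) * (1 - a d) with hF
  have step (e : ℤ) : F (e + 1) = F e := by
    have := (h2 (e + 1)).unique (hasSum_mul_chainMatrix a Ψ (e + 1))
    simp only [hF]
    rw [add_sub_cancel_right] at this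
    linarith
  have hconst (e : ℤ) : F e = F d := by
    have key (n : ℕ) (m : ℤ) : F (m + n) = F m := by
      induction n with
      | zero => simp
      | succ n ih => rw [Nat.cast_succ, ← add_assoc, step, ih]
    rcases le_total d e with hde | hde
    · have := key (e - d).toNat d
      rwa [Int.toNat_of_nonneg (by omega), add_sub_cancel] at this
    · have := key (d - e).toNat e
      rw [Int.toNat_of_nonneg (by omega), add_sub_cancel] at this
      exact this.symm
  have hs : Summable F := by
    refine Summable.sub ?_ ?_
    · exact h1.summable.of_nonneg_of_le (fun e => mul_nonneg (h0 e) (h.pos e).le)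
        fun e => mul_le_of_le_one_right (h0 e) (h.lt_one e).le
    · refine ((Equiv.addRight (1 : ℤ)).summable_iff.2 h1.summable).of_nonneg_of_le
        (fun e => mul_nonneg (h0 _) (sub_nonneg.2 (h.lt_one e).le))
        fun e => mul_le_of_le_one_right (h0 _) (by linarith [h.pos e])
  -- A summable constant sequence on the infinite index set `ℤ` vanishes.
  have hz : F d = 0 := by
    rw [funext hconst] at hs
    exact (summable_const_iff _).1 hs
  exact sub_eq_zero.1 hz

lemma eq_stationary_of_isInvariantProb {a Ψ : ℤ → ℝ} (h : IsCrossing a)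
    (hΨ : IsInvariantProb (chainMatrix a) Ψ) : Ψ = stationary a := by
  have hprop (d : ℤ) : Ψ d = Ψ 0 * weight a d := by
    induction d using Int.induction_on with
    | zero => simp [weight]
    | succ n ih =>
      have h1 := hΨ.balance h n
      have h2 := weight_balance h n
      have h3 := sub_pos.2 (h.lt_one n)
      refine mul_right_cancel₀ h3.ne' ?_
      rw [← h1, ih, mul_assoc, h2, mul_assoc]
    | pred n ih =>
      have h1 := hΨ.balance h (-n - 1)
      have h2 := weight_balance h (-n - 1)
      rw [sub_add_cancel] at h1 h2
      refine mul_right_cancel₀ (h.pos (-n - 1)).ne' ?_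
      rw [h1, ih, mul_assoc, mul_assoc, h2]
  have hsum := (summable_weight h).hasSum.mul_left (Ψ 0)
  rw [← funext hprop] at hsum
  have h1 := hΨ.2.1.unique hsum
  ext d
  rw [hprop, stationary, eq_div_iff (tsum_weight_pos h).ne', mul_right_comm, ← h1, one_mul]

lemma meanErr_nonneg {a : ℤ → ℝ} (h : IsCrossing a) (d : ℤ) : 0 ≤ meanErr a d := by
  have := h.pos d
  have := h.lt_one (d - 1)
  rw [meanErr]
  linarith

lemma meanErr_le_one {a : ℤ → ℝ} (h : IsCrossing a) (d : ℤ) : meanErr a d ≤ 1 := by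
  have := h.lt_one d
  have := h.pos (d - 1)
  rw [meanErr]
  linarith

lemma summable_meanErr_mul {a : ℤ → ℝ} (h : IsCrossing a) :
    Summable (fun d => meanErr a d * stationary a d) :=
  (hasSum_stationary h).summable.of_nonneg_of_le
    (fun d => mul_nonneg (meanErr_nonneg h d) (stationary_pos h d).le)
    fun d => mul_le_of_le_one_left (stationary_pos h d).le (meanErr_le_one h d)

/-- The stationary error rate. -/
def errRate (a : ℤ → ℝ) : ℝ := ∑' d, meanErr a d * stationary a d

lemma errRate_nonneg {a : ℤ → ℝ} (h : IsCrossing a) : 0 ≤ errRate a :=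
  tsum_nonneg fun d => mul_nonneg (meanErr_nonneg h d) (stationary_pos h d).le

lemma errRate_le_one {a : ℤ → ℝ} (h : IsCrossing a) : errRate a ≤ 1 := by
  rw [← (hasSum_stationary h).tsum_eq]
  exact (summable_meanErr_mul h).tsum_le_tsum
    (fun d => mul_le_of_le_one_left (stationary_pos h d).le (meanErr_le_one h d))
    (hasSum_stationary h).summable

/-! ### The Poisson equation -/

/-- The contribution of the state `e` to the partial sums that solve the Poisson equation; over
all of `ℤ` these contributions sum to zero. -/
def centred (a : ℤ → ℝ) (e : ℤ) : ℝ := stationary a e * (errRate a - meanErr a e)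

lemma hasSum_centred {a : ℤ → ℝ} (h : IsCrossing a) : HasSum (centred a) 0 := by
  have h1 := ((hasSum_stationary h).mul_right (errRate a)).sub (summable_meanErr_mul h).hasSum
  rw [one_mul] at h1
  have h2 : errRate a - ∑' d, meanErr a d * stationary a d = 0 := sub_self _
  rw [h2] at h1
  convert! h1 using 2 with e
  rw [centred]
  ring

lemma abs_centred_le {a : ℤ → ℝ} (h : IsCrossing a) (e : ℤ) :
    |centred a e| ≤ stationary a e := by
  rw [centred, abs_mul, abs_of_pos (stationary_pos h e)]
  refine mul_le_of_le_one_right (stationary_pos h e).le (abs_le.2 ⟨?_, ?_⟩)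
  · linarith [meanErr_le_one h e, errRate_nonneg h]
  · linarith [meanErr_nonneg h e, errRate_le_one h]

/-- The partial sum of `f` over the states `e ≤ d`. -/
def lowerSum (f : ℤ → ℝ) (d : ℤ) : ℝ := ∑' e, (Set.Iic d).indicator f e

/-- The partial sum of `f` over the states `e > d`. -/
def upperSum (f : ℤ → ℝ) (d : ℤ) : ℝ := ∑' e, (Set.Ioi d).indicator f e

lemma lowerSum_add_upperSum {f : ℤ → ℝ} (hf : Summable f) (d : ℤ) :
    lowerSum f d + upperSum f d = ∑' e, f e := by
  rw [lowerSum, upperSum, ← (hf.indicator _).tsum_add (hf.indicator _)]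
  congr 1
  ext e
  have := congrFun (Set.indicator_self_add_compl (Set.Iic d) f) e
  rwa [Set.compl_Iic] at this

lemma lowerSum_eq_add {f : ℤ → ℝ} (hf : Summable f) (d : ℤ) :
    lowerSum f d = lowerSum f (d - 1) + f d := by
  have h1 : HasSum (({d} : Set ℤ).indicator f) (f d) := by
    have := hasSum_ite_eq d (f d)
    convert! this using 2 with e
    by_cases he : e = d <;> simp [he]
  rw [lowerSum, lowerSum, ← h1.tsum_eq, ← (hf.indicator _).tsum_add h1.summable]
  congr 1
  ext e
  simp only [Set.indicator_apply, Set.mem_Iic, Set.mem_singleton_iff]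
  split_ifs <;> first | omega | simp

lemma abs_lowerSum_le {f g : ℤ → ℝ} (hg : Summable g) (hfg : ∀ e, |f e| ≤ g e) (d : ℤ) :
    |lowerSum f d| ≤ lowerSum g d :=
  tsum_of_norm_bounded (f := (Set.Iic d).indicator f) (hg.indicator (Set.Iic d)).hasSum fun e => by
    by_cases he : e ≤ d <;> simp [he, hfg]

lemma abs_upperSum_le {f g : ℤ → ℝ} (hg : Summable g) (hfg : ∀ e, |f e| ≤ g e) (d : ℤ) :
    |upperSum f d| ≤ upperSum g d :=
  tsum_of_norm_bounded (f := (Set.Ioi d).indicator f) (hg.indicator (Set.Ioi d)).hasSum fun e => by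
    by_cases he : d < e <;> simp [he, hfg]

/-- A summable sequence that decays geometrically to the left of `d` has its left tail controlled
by its last term. -/
lemma lowerSum_le {g : ℤ → ℝ} (hg : Summable g) {ρ : ℝ} {d : ℤ}
    (hρ : ∀ e ≤ d, g (e - 1) ≤ ρ * g e) : lowerSum g d * (1 - ρ) ≤ g d := by
  have h1 : lowerSum g (d - 1) ≤ ρ * lowerSum g d := by
    have h2 : HasSum (fun e => (Set.Iic (d - 1)).indicator g (e - 1)) (lowerSum g (d - 1)) := by
      have := (Equiv.subRight (1 : ℤ)).hasSum_iff (f := (Set.Iic (d - 1)).indicator g)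
        (a := lowerSum g (d - 1))
      exact this.2 (hg.indicator (Set.Iic (d - 1))).hasSum
    have h3 : HasSum (fun e => ρ * (Set.Iic d).indicator g e) (ρ * lowerSum g d) :=
      (hg.indicator (Set.Iic d)).hasSum.mul_left ρ
    refine hasSum_le (fun e => ?_) h2 h3
    by_cases he : e ≤ d
    · simpa [Set.indicator_apply, he] using hρ e he
    · simp [he]
  linarith [lowerSum_eq_add hg d]

lemma upperSum_eq_lowerSum_neg (g : ℤ → ℝ) (d : ℤ) :
    upperSum g d = lowerSum (fun e => g (-e)) (-d - 1) := by
  rw [upperSum, lowerSum, ← (Equiv.neg ℤ).tsum_eq ((Set.Ioi d).indicator g)]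
  congr 1
  ext e
  simp only [Set.indicator_apply, Equiv.neg_apply, Set.mem_Ioi, Set.mem_Iic]
  split_ifs <;> first | omega | rfl

/-- The increment `g (d + 1) - g d` of a solution `g` of the Poisson equation. -/
def poissonStep (a : ℤ → ℝ) (d : ℤ) : ℝ :=
  lowerSum (centred a) d / (stationary a d * (a d / 2))

lemma poissonStep_spec {a : ℤ → ℝ} (h : IsCrossing a) (d : ℤ) :
    a d / 2 * poissonStep a d - (1 - a (d - 1)) / 2 * poissonStep a (d - 1)
      = errRate a - meanErr a d := by
  have h1 := lowerSum_eq_add (hasSum_centred h).summable d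
  have h2 := stationary_balance h (d - 1)
  rw [sub_add_cancel] at h2
  have h3 := h.pos d
  have h4 := stationary_pos h d
  have h5 := sub_pos.2 (h.lt_one (d - 1))
  rw [poissonStep, poissonStep, h1, centred, ← mul_div_assoc (stationary a (d - 1)), h2]
  field_simp
  ring

/-- The increments of the Poisson solution are bounded, since the left or right tail of the
stationary vector is at most a constant times its largest term. -/
lemma abs_poissonStep_le {a : ℤ → ℝ} (h : IsCrossing a) (d : ℤ) :
    |poissonStep a d| ≤ 4 / (1 - a 0 / (1 - a 0)) := by
  set ρ := a 0 / (1 - a 0) with hρ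
  have hhalf := h.zero_lt_half
  have hρ1 : ρ < 1 := by rw [hρ, div_lt_one] <;> linarith
  have hsum := (hasSum_stationary h).summable
  have hc := hasSum_centred h
  have hpos := stationary_pos h
  have hw : 0 < stationary a d * (a d / 2) := mul_pos (hpos d) (by linarith [h.pos d])
  rw [poissonStep, abs_div, abs_of_pos hw, div_le_div_iff₀ hw (by linarith)]
  rcases le_or_gt 0 d with hd | hd
  -- To the right of `0` the sum over `e ≤ d` is replaced by minus the sum over `e > d`, because
  -- `centred a` sums to zero and only the right tail of the stationary vector is small there.
  · have h1 : lowerSum (centred a) d = -upperSum (centred a) d := by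
      linarith [lowerSum_add_upperSum hc.summable d, hc.tsum_eq]
    have h2 : |lowerSum (centred a) d| ≤ upperSum (stationary a) d := by
      rw [h1, abs_neg]
      exact abs_upperSum_le hsum (abs_centred_le h) d
    have h3 : upperSum (stationary a) d * (1 - ρ) ≤ stationary a (d + 1) := by
      rw [upperSum_eq_lowerSum_neg]
      have := lowerSum_le (g := fun e => stationary a (-e)) (ρ := ρ) (d := -d - 1)
        ((Equiv.neg ℤ).summable_iff.2 hsum) (fun e he => ?_)
      · simpa [add_comm] using this
      · have hb := stationary_balance h (-e)
        have := h.antitone (show 0 ≤ -e by omega)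
        have := hpos (-e)
        have := hpos (-e + 1)
        rw [show -(e - 1) = -e + 1 by ring, hρ, div_mul_eq_mul_div, le_div_iff₀ (by linarith)]
        calc stationary a (-e + 1) * (1 - a 0) ≤ stationary a (-e + 1) * (1 - a (-e)) := by gcongr
          _ = stationary a (-e) * a (-e) := hb.symm
          _ ≤ a 0 * stationary a (-e) := by rw [mul_comm]; gcongr
    have h4 := stationary_balance h d
    have h5 := h.antitone hd
    have h6 := hpos (d + 1)
    have h7 : |lowerSum (centred a) d| * (1 - ρ) ≤ upperSum (stationary a) d * (1 - ρ) :=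
      mul_le_mul_of_nonneg_right h2 (by linarith)
    nlinarith
  · have h2 : |lowerSum (centred a) d| ≤ lowerSum (stationary a) d :=
      abs_lowerSum_le hsum (abs_centred_le h) d
    have hneg (e : ℤ) (he : e ≤ -1) : 1 - a 0 ≤ a e := by
      have := h.antitone (show e ≤ -1 - 0 by omega)
      rwa [h.reflect] at this
    have h3 : lowerSum (stationary a) d * (1 - ρ) ≤ stationary a d := by
      refine lowerSum_le hsum fun e he => ?_
      have hb := stationary_balance h (e - 1)
      rw [sub_add_cancel] at hb
      have := hneg (e - 1) (by omega)
      have := hpos (e - 1)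
      have := hpos e
      rw [hρ, div_mul_eq_mul_div, le_div_iff₀ (by linarith)]
      calc stationary a (e - 1) * (1 - a 0) ≤ stationary a (e - 1) * a (e - 1) := by gcongr
        _ = stationary a e * (1 - a (e - 1)) := hb
        _ ≤ a 0 * stationary a e := by rw [mul_comm]; gcongr; linarith
    have h5 := hneg d (by omega)
    have h6 := hpos d
    have h7 : |lowerSum (centred a) d| * (1 - ρ) ≤ lowerSum (stationary a) d * (1 - ρ) :=
      mul_le_mul_of_nonneg_right h2 (by linarith)
    nlinarith

/-- A solution `g` of the Poisson equation `(1 - P̄) g = q̄ - c`, normalised by `g 0 = 0`, where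
`P̄` is the chain matrix and `c` the stationary mean of `q̄`. -/
def poissonSol (a : ℤ → ℝ) : ℤ → ℝ
  | Int.ofNat n => ∑ i ∈ Finset.range n, poissonStep a i
  | Int.negSucc n => -∑ i ∈ Finset.range (n + 1), poissonStep a (-1 - i)

lemma poissonSol_zero (a : ℤ → ℝ) : poissonSol a 0 = 0 :=
  Finset.sum_range_zero _

lemma poissonSol_succ (a : ℤ → ℝ) (d : ℤ) :
    poissonSol a (d + 1) = poissonSol a d + poissonStep a d := by
  rcases d with n | n
  · exact Finset.sum_range_succ _ _
  · have h1 : poissonSol a (Int.negSucc n + 1)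
        = -∑ i ∈ Finset.range n, poissonStep a (-1 - i) := by
      cases n with
      | zero => exact (poissonSol_zero a).trans (by simp)
      | succ n => rfl
    rw [h1, poissonSol, Finset.sum_range_succ, Int.negSucc_eq]
    have : -((n : ℤ) + 1) = -1 - n := by ring
    rw [this]
    ring

lemma abs_poissonSol_le {a : ℤ → ℝ} {L : ℝ} (hL : ∀ d, |poissonStep a d| ≤ L) (d : ℤ) :
    |poissonSol a d| ≤ L * |(d : ℝ)| := by
  induction d using Int.induction_on with
  | zero => simp [poissonSol_zero]
  | succ n ih =>
    have h1 := abs_add_le (poissonSol a n) (poissonStep a n)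
    have h2 := hL n
    have h5 : |((n + 1 : ℤ) : ℝ)| = |((n : ℤ) : ℝ)| + 1 := by
      push_cast
      rw [abs_of_nonneg (by positivity : (0 : ℝ) ≤ n), abs_of_nonneg (by positivity)]
    rw [poissonSol_succ, h5]
    linarith
  | pred n ih =>
    have h1 := poissonSol_succ a (-n - 1)
    rw [sub_add_cancel] at h1
    have h3 : poissonSol a (-n - 1) = poissonSol a (-n) - poissonStep a (-n - 1) := by linarith
    have h4 := abs_sub (poissonSol a (-n)) (poissonStep a (-n - 1))
    have h2 := hL (-n - 1)
    have h5 : |((-n - 1 : ℤ) : ℝ)| = |((-n : ℤ) : ℝ)| + 1 := by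
      push_cast
      rw [abs_neg, ← neg_add', abs_neg, abs_of_nonneg (by positivity : (0 : ℝ) ≤ n),
        abs_of_nonneg (by positivity)]
    rw [h3, h5]
    linarith

/-! ### A strong law from second moments -/

lemma abs_sub_le_of_abs_succ_sub_le {r : ℕ → ℝ} {B : ℝ} (hB : ∀ K, |r (K + 1) - r K| ≤ B)
    (m n : ℕ) : |r (m + n) - r m| ≤ B * n := by
  induction n with
  | zero => simp
  | succ n ih =>
    have := abs_sub_le (r (m + (n + 1))) (r (m + n)) (r m)
    have := hB (m + n)
    push_cast
    rw [← add_assoc] at *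
    linarith

/-- A sequence with bounded increments whose averages tend to zero along the squares has averages
tending to zero, since consecutive squares `n ^ 2`, `(n + 1) ^ 2` are only `2 * n + 1` apart. -/
lemma tendsto_div_of_tendsto_sq {r : ℕ → ℝ} {B : ℝ} (hB : ∀ K, |r (K + 1) - r K| ≤ B)
    (hr : Tendsto (fun n : ℕ => r (n ^ 2) / (n : ℝ) ^ 2) atTop (𝓝 0)) :
    Tendsto (fun K : ℕ => r K / K) atTop (𝓝 0) := by
  have hsqrt : Tendsto Nat.sqrt atTop atTop :=
    tendsto_atTop_atTop.2 fun b => ⟨b ^ 2, fun K hK => Nat.le_sqrt'.2 hK⟩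
  have hB0 : 0 ≤ B := (abs_nonneg _).trans (hB 0)
  have h1 : Tendsto (fun n : ℕ => |r (n ^ 2) / (n : ℝ) ^ 2| + 2 * B / n) atTop (𝓝 0) := by
    simpa using hr.abs.add (tendsto_const_div_atTop_nhds_zero_nat (2 * B))
  refine squeeze_zero_norm' ?_ (h1.comp hsqrt)
  filter_upwards [eventually_ge_atTop 1] with K hK
  have hs : 0 < Nat.sqrt K := Nat.sqrt_pos.2 hK
  have hle : Nat.sqrt K ^ 2 ≤ K := Nat.sqrt_le' K
  have hK2 : K ≤ Nat.sqrt K ^ 2 + 2 * Nat.sqrt K := by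
    have := Nat.lt_succ_sqrt' K
    rw [Nat.succ_eq_add_one] at this
    nlinarith
  obtain ⟨j, hj⟩ := Nat.exists_eq_add_of_le hle
  have h2 := abs_sub_le_of_abs_succ_sub_le hB (Nat.sqrt K ^ 2) j
  rw [← hj] at h2
  set s := Nat.sqrt K
  have hs' : (0 : ℝ) < s := by exact_mod_cast hs
  have hj2 : (j : ℝ) ≤ 2 * s := by exact_mod_cast (by omega : j ≤ 2 * s)
  have h3 : |r K| ≤ |r (s ^ 2)| + 2 * B * s := by
    have := abs_sub_abs_le_abs_sub (r K) (r (s ^ 2))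
    nlinarith
  have hKs : (s : ℝ) ^ 2 ≤ K := by exact_mod_cast hle
  simp only [Function.comp_apply]
  rw [Real.norm_eq_abs, abs_div, abs_div, abs_of_nonneg (by positivity : (0 : ℝ) ≤ K),
    abs_of_nonneg (by positivity : (0 : ℝ) ≤ (s : ℝ) ^ 2)]
  calc |r K| / K ≤ |r K| / (s : ℝ) ^ 2 := by gcongr
    _ ≤ (|r (s ^ 2)| + 2 * B * s) / (s : ℝ) ^ 2 := by gcongr
    _ = |r (s ^ 2)| / (s : ℝ) ^ 2 + 2 * B / s := by field_simp

lemma ae_summable_of_summable_integral {α : Type*} [MeasurableSpace α] {μ : Measure α}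
    {f : ℕ → α → ℝ} (hf : ∀ n, Integrable (f n) μ) (hf0 : ∀ n x, 0 ≤ f n x)
    (hs : Summable fun n => ∫ x, f n x ∂μ) : ∀ᵐ x ∂μ, Summable fun n => f n x := by
  have h1 : ∫⁻ x, ∑' n, ENNReal.ofReal (f n x) ∂μ ≠ ⊤ := by
    rw [lintegral_tsum fun n => (hf n).aemeasurable.ennreal_ofReal]
    simp_rw [← ofReal_integral_eq_lintegral_ofReal (hf _) (ae_of_all _ (hf0 _))]
    rw [← ENNReal.ofReal_tsum_of_nonneg (fun n => integral_nonneg (hf0 n)) hs]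
    exact ENNReal.ofReal_ne_top
  filter_upwards [ae_lt_top' (AEMeasurable.tsum
    fun n => (hf n).aemeasurable.ennreal_ofReal) h1] with x hx
  have := ENNReal.summable_toReal hx.ne
  simpa [ENNReal.toReal_ofReal (hf0 _ _)] using this

/-- A strong law for partial sums with bounded increments and linearly growing second moments:
the averages tend to zero along the squares by Borel–Cantelli, hence altogether. -/
lemma ae_tendsto_div_of_integral_sq_le {α : Type*} [MeasurableSpace α] {μ : Measure α}
    {R : ℕ → α → ℝ} {A B : ℝ} (hR : ∀ K, Integrable (fun x => R K x ^ 2) μ)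
    (hA : ∀ K : ℕ, ∫ x, R K x ^ 2 ∂μ ≤ A * K) (hB : ∀ K x, |R (K + 1) x - R K x| ≤ B) :
    ∀ᵐ x ∂μ, Tendsto (fun K : ℕ => R K x / K) atTop (𝓝 0) := by
  have hsum : Summable fun n : ℕ => ∫ x, (R (n ^ 2) x / (n : ℝ) ^ 2) ^ 2 ∂μ := by
    refine Summable.of_nonneg_of_le (fun n => integral_nonneg fun x => sq_nonneg _) (fun n => ?_)
      ((Real.summable_one_div_nat_pow.2 one_lt_two).mul_left A)
    simp_rw [div_pow]
    rw [integral_div]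
    rcases Nat.eq_zero_or_pos n with rfl | hn
    · simp
    · have hn' : (0 : ℝ) < n := by exact_mod_cast hn
      rw [div_le_iff₀ (by positivity)]
      refine (hA (n ^ 2)).trans (le_of_eq ?_)
      push_cast
      field_simp
  filter_upwards [ae_summable_of_summable_integral
    (fun n => by simp_rw [div_pow]; exact (hR _).div_const _) (fun n x => sq_nonneg _) hsum]
    with x hx
  refine tendsto_div_of_tendsto_sq (fun K => hB K x) ?_
  have := hx.tendsto_atTop_zero.sqrt
  simp_rw [Real.sqrt_sq_eq_abs, Real.sqrt_zero] at this
  exact (tendsto_zero_iff_abs_tendsto_zero _).2 this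

/-! ### Means for a fixed bit sequence -/

/-- The action on functions of one step of the difference chain driven by the bit `b`:
`stepOp a b f d` is the mean of `f` after a step from `d`. -/
def stepOp (a : ℤ → ℝ) : Bool → (ℤ → ℝ) → ℤ → ℝ
  | false, f, d => a d * f (d + 1) + (1 - a d) * f d
  | true, f, d => a (d - 1) * f d + (1 - a (d - 1)) * f (d - 1)

/-- The mean of `f` at the difference after `k` steps from `0`, for the fixed bit sequence `u`. -/
def quenched (a : ℤ → ℝ) (u : ℕ → Bool) : ℕ → (ℤ → ℝ) → ℝ
  | 0, f => f 0
  | k + 1, f => quenched a u k (stepOp a (u k) f)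

lemma abs_stepOp_le {a : ℤ → ℝ} (h : IsCrossing a) (b : Bool) {f : ℤ → ℝ} {C : ℝ}
    (hf : ∀ d, |f d| ≤ C) (d : ℤ) : |stepOp a b f d| ≤ C := by
  have key (p x y : ℝ) (hp0 : 0 < p) (hp1 : p < 1) (hx : |x| ≤ C) (hy : |y| ≤ C) :
      |p * x + (1 - p) * y| ≤ C := by
    rw [abs_le] at *
    constructor <;> nlinarith
  cases b <;> exact key _ _ _ (h.pos _) (h.lt_one _) (hf _) (hf _)

lemma quenched_congr {a : ℤ → ℝ} {u v : ℕ → Bool} {k : ℕ} (h : ∀ j < k, u j = v j) (f : ℤ → ℝ) :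
    quenched a u k f = quenched a v k f := by
  induction k generalizing f with
  | zero => rfl
  | succ k ih => rw [quenched, quenched, h k k.lt_succ_self, ih fun j hj => h j (by omega)]

lemma quenched_add (a : ℤ → ℝ) (u : ℕ → Bool) (k : ℕ) (f g : ℤ → ℝ) :
    quenched a u k (f + g) = quenched a u k f + quenched a u k g := by
  induction k generalizing f g with
  | zero => rfl
  | succ k ih =>
    rw [quenched, quenched, quenched, ← ih]
    congr 1
    ext d
    cases u k <;> simp [stepOp] <;> ring

lemma quenched_smul (a : ℤ → ℝ) (u : ℕ → Bool) (k : ℕ) (c : ℝ) (f : ℤ → ℝ) :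
    quenched a u k (c • f) = c * quenched a u k f := by
  induction k generalizing f with
  | zero => rfl
  | succ k ih =>
    rw [quenched, quenched, ← ih]
    congr 1
    ext d
    cases u k <;> simp [stepOp] <;> ring

lemma quenched_sub (a : ℤ → ℝ) (u : ℕ → Bool) (k : ℕ) (f g : ℤ → ℝ) :
    quenched a u k (f - g) = quenched a u k f - quenched a u k g := by
  have := quenched_add a u k (f - g) g
  rw [sub_add_cancel] at this
  linarith

lemma quenched_const (a : ℤ → ℝ) (u : ℕ → Bool) (k : ℕ) (c : ℝ) :
    quenched a u k (fun _ => c) = c := by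
  induction k with
  | zero => rfl
  | succ k ih =>
    rw [quenched]
    convert ih using 2
    ext d
    cases u k <;> simp [stepOp] <;> ring

lemma quenched_mono {a : ℤ → ℝ} (h : IsCrossing a) (u : ℕ → Bool) (k : ℕ) {f g : ℤ → ℝ}
    (hfg : ∀ d, f d ≤ g d) : quenched a u k f ≤ quenched a u k g := by
  induction k generalizing f g with
  | zero => exact hfg 0
  | succ k ih =>
    refine ih fun d => ?_
    cases u k <;> simp only [stepOp] <;>
    exact add_le_add (mul_le_mul_of_nonneg_left (hfg _) (h.pos _).le)
      (mul_le_mul_of_nonneg_left (hfg _) (sub_pos.2 (h.lt_one _)).le)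

lemma abs_quenched_le {a : ℤ → ℝ} (h : IsCrossing a) (u : ℕ → Bool) (k : ℕ) {f : ℤ → ℝ} {C : ℝ}
    (hf : ∀ d, |f d| ≤ C) : |quenched a u k f| ≤ C := by
  refine abs_le.2 ⟨?_, ?_⟩
  · rw [← quenched_const a u k (-C)]
    exact quenched_mono h u k fun d => (abs_le.1 (hf d)).1
  · rw [← quenched_const a u k C]
    exact quenched_mono h u k fun d => (abs_le.1 (hf d)).2

/-- Jensen's inequality for the square. -/
lemma quenched_sq_le {a : ℤ → ℝ} (h : IsCrossing a) (u : ℕ → Bool) (k : ℕ) (f : ℤ → ℝ) :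
    quenched a u k f ^ 2 ≤ quenched a u k (fun d => f d ^ 2) := by
  set m := quenched a u k f with hm
  -- The mean of the tangent `2 m f - m ^ 2` of the square at `m` is a lower bound.
  have h1 : 2 * m * m - m ^ 2 ≤ quenched a u k (fun d => f d ^ 2) := by
    calc 2 * m * m - m ^ 2 = quenched a u k ((2 * m) • f - fun _ => m ^ 2) := by
          rw [quenched_sub, quenched_smul, quenched_const]
      _ ≤ _ := quenched_mono h u k fun d => by
          simp only [Pi.sub_apply, Pi.smul_apply, smul_eq_mul]
          nlinarith [sq_nonneg (f d - m)]
  nlinarith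

lemma measurable_quenched_bit (a : ℤ → ℝ) (k : ℕ) (F : Bool → ℤ → ℝ)
    (hF : ∀ b, Measurable fun u => quenched a u k (F b)) :
    Measurable fun u : ℕ → Bool => quenched a u k (F (u k)) := by
  have : (fun u : ℕ → Bool => quenched a u k (F (u k)))
      = fun u => if u k = true then quenched a u k (F true) else quenched a u k (F false) := by
    ext u
    cases u k <;> simp
  rw [this]
  exact Measurable.ite (measurableSet_eq_fun (measurable_pi_apply k) measurable_const)
    (hF true) (hF false)

lemma measurable_quenched (a : ℤ → ℝ) (k : ℕ) (f : ℤ → ℝ) :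
    Measurable fun u => quenched a u k f := by
  induction k generalizing f with
  | zero => exact measurable_const
  | succ k ih => exact measurable_quenched_bit a k (fun b => stepOp a b f) fun b => ih _

/-- For a fixed time, the quenched mean is bounded uniformly in the bit sequence, whatever the
growth of `f`, because it depends on finitely many bits only. -/
lemma exists_abs_quenched_le (a : ℤ → ℝ) (k : ℕ) (f : ℤ → ℝ) :
    ∃ C, ∀ u, |quenched a u k f| ≤ C := by
  induction k generalizing f with
  | zero => exact ⟨|f 0|, fun u => le_rfl⟩
  | succ k ih =>
    obtain ⟨C, hC⟩ := ih (stepOp a false f)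
    obtain ⟨D, hD⟩ := ih (stepOp a true f)
    refine ⟨max C D, fun u => ?_⟩
    rw [quenched]
    cases u k
    · exact (hC u).trans (le_max_left _ _)
    · exact (hD u).trans (le_max_right _ _)

/-! ### Second moments under inversion of a bit -/

/-- Inversion of the bit `k` of a sequence. -/
def flipBit (k : ℕ) (u : ℕ → Bool) (i : ℕ) : Bool := if i = k then !u i else u i

lemma fairBit_map_not : fairBit.map not = fairBit := by
  rw [fairBit, PMF.toMeasure_map _ _ (measurable_of_finite _)]
  congr 1
  ext b
  rw [PMF.map_apply]
  cases b <;> simp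

instance : IsProbabilityMeasure bernoulliMeasure := by
  unfold bernoulliMeasure
  infer_instance

lemma measurePreserving_flipBit (k : ℕ) :
    MeasurePreserving (flipBit k) bernoulliMeasure bernoulliMeasure := by
  have h1 : flipBit k = fun (u : ℕ → Bool) i => (if i = k then not else id) (u i) := by
    ext u i
    rw [flipBit]
    split_ifs <;> rfl
  have h2 (i : ℕ) : Measurable (if i = k then not else id : Bool → Bool) := measurable_of_finite _
  refine ⟨?_, ?_⟩
  · rw [h1]
    exact measurable_pi_lambda _ fun i => (h2 i).comp (measurable_pi_apply i)
  · rw [h1, bernoulliMeasure, Measure.infinitePi_map_pi _ h2]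
    congr 1
    ext1 i
    split_ifs
    · exact fairBit_map_not
    · exact Measure.map_id

lemma integral_comp_flipBit (k : ℕ) {F : (ℕ → Bool) → ℝ} (hF : Measurable F) :
    ∫ u, F (flipBit k u) ∂bernoulliMeasure = ∫ u, F u ∂bernoulliMeasure := by
  have h := measurePreserving_flipBit k
  conv_rhs => rw [← h.map_eq]
  exact (integral_map h.measurable.aemeasurable hF.aestronglyMeasurable).symm

lemma integrable_of_abs_le {F : (ℕ → Bool) → ℝ} (hF : Measurable F) {C : ℝ}
    (hC : ∀ u, |F u| ≤ C) : Integrable F bernoulliMeasure :=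
  Integrable.of_bound hF.aestronglyMeasurable C (ae_of_all _ hC)

lemma quenched_flipBit (a : ℤ → ℝ) (u : ℕ → Bool) {j k : ℕ} (hjk : j ≤ k) (f : ℤ → ℝ) :
    quenched a (flipBit k u) j f = quenched a u j f :=
  quenched_congr (fun i hi => by rw [flipBit, if_neg (by omega)]) f

lemma integrable_quenched (a : ℤ → ℝ) (k : ℕ) (f : ℤ → ℝ) :
    Integrable (fun u => quenched a u k f) bernoulliMeasure := by
  obtain ⟨C, hC⟩ := exists_abs_quenched_le a k f
  exact integrable_of_abs_le (measurable_quenched a k f) hC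

/-- The difference chain drifts towards zero, so that one step under a uniform bit raises the
square of the difference by at most `1 / 2` on average. -/
lemma stepOp_sq_le {a : ℤ → ℝ} (h : IsCrossing a) (d : ℤ) :
    stepOp a false (fun e => (e : ℝ) ^ 2) d + stepOp a true (fun e => (e : ℝ) ^ 2) d
      ≤ 2 * (d : ℝ) ^ 2 + 1 := by
  have h1 := h.antitone (show d - 1 ≤ d by omega)
  have h2 : (d : ℝ) * (a d + a (d - 1) - 1) ≤ 0 := by
    have h0 := h.zero_lt_half
    rcases lt_trichotomy d 0 with hd | rfl | hd
    · have h3 := h.antitone (show d ≤ -1 - 0 by omega)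
      rw [h.reflect] at h3
      have : (d : ℝ) < 0 := by exact_mod_cast hd
      exact mul_nonpos_of_nonpos_of_nonneg this.le (by linarith)
    · simp
    · have h3 := h.antitone (show 0 ≤ d - 1 by omega)
      have : (0 : ℝ) < d := by exact_mod_cast hd
      exact mul_nonpos_of_nonneg_of_nonpos this.le (by linarith)
  simp only [stepOp]
  push_cast
  nlinarith

lemma integral_quenched_sq_le {a : ℤ → ℝ} (h : IsCrossing a) (k : ℕ) :
    ∫ u, quenched a u k (fun d => (d : ℝ) ^ 2) ∂bernoulliMeasure ≤ k := by
  induction k with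
  | zero => simp [quenched]
  | succ k ih =>
    set sq : ℤ → ℝ := fun d => (d : ℝ) ^ 2
    have h1 := integral_comp_flipBit k (measurable_quenched a (k + 1) sq)
    have h2 : Integrable (fun u => quenched a (flipBit k u) (k + 1) sq) bernoulliMeasure :=
      (measurePreserving_flipBit k).integrable_comp_of_integrable (integrable_quenched a (k + 1) sq)
    have h3 (u : ℕ → Bool) : quenched a u (k + 1) sq + quenched a (flipBit k u) (k + 1) sq
        ≤ 2 * quenched a u k sq + 1 := by
      have h4 : quenched a u (k + 1) sq + quenched a (flipBit k u) (k + 1) sq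
          = quenched a u k (stepOp a false sq + stepOp a true sq) := by
        rw [quenched, quenched, quenched_flipBit a u le_rfl, ← quenched_add, flipBit, if_pos rfl]
        cases u k
        · rfl
        · rw [add_comm]
          rfl
      rw [h4]
      calc _ ≤ quenched a u k ((2 : ℝ) • sq + fun _ => 1) :=
            quenched_mono h u k (stepOp_sq_le h)
        _ = _ := by rw [quenched_add, quenched_smul, quenched_const]
    have h5 := integral_mono ((integrable_quenched a (k + 1) sq).add h2)
      (((integrable_quenched a k sq).const_mul 2).add (integrable_const 1)) h3
    simp only [Pi.add_apply] at h5
    rw [integral_add (integrable_quenched a (k + 1) sq) h2,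
      integral_add ((integrable_quenched a k sq).const_mul 2) (integrable_const 1),
      integral_const_mul, h1] at h5
    simp at h5
    push_cast
    linarith

/-! ### Corrected errors and the ergodic theorem -/

/-- The corrected error: the error probability, centred, plus the change of the Poisson solution
over one step. Averaged over a uniform bit it vanishes. -/
def corrErr (a : ℤ → ℝ) (b : Bool) : ℤ → ℝ :=
  (stepOp a b (poissonSol a) - poissonSol a) + (errProb a b - fun _ => errRate a)

lemma corrErr_false (a : ℤ → ℝ) (d : ℤ) :
    corrErr a false d = a d * poissonStep a d + (a d - errRate a) := by
  simp only [corrErr, stepOp, errProb, Pi.add_apply, Pi.sub_apply, poissonSol_succ]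
  ring

lemma corrErr_true (a : ℤ → ℝ) (d : ℤ) :
    corrErr a true d = -((1 - a (d - 1)) * poissonStep a (d - 1))
      + (1 - a (d - 1) - errRate a) := by
  have := poissonSol_succ a (d - 1)
  rw [sub_add_cancel] at this
  simp only [corrErr, stepOp, errProb, Pi.add_apply, Pi.sub_apply]
  rw [this]
  ring

lemma corrErr_not {a : ℤ → ℝ} (h : IsCrossing a) (b : Bool) :
    corrErr a (!b) = (-1 : ℝ) • corrErr a b := by
  have key (d : ℤ) : corrErr a true d = -corrErr a false d := by
    have := poissonStep_spec h d
    rw [meanErr] at this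
    rw [corrErr_true, corrErr_false]
    linarith
  ext d
  cases b <;> simp [key]

lemma abs_corrErr_le {a : ℤ → ℝ} (h : IsCrossing a) {L : ℝ} (hL : ∀ d, |poissonStep a d| ≤ L)
    (b : Bool) (d : ℤ) : |corrErr a b d| ≤ L + 1 := by
  have key (d : ℤ) : |corrErr a false d| ≤ L + 1 := by
    rw [corrErr_false]
    have h1 : |a d * poissonStep a d| ≤ L := by
      rw [abs_mul, abs_of_pos (h.pos d)]
      exact (mul_le_of_le_one_left (abs_nonneg _) (h.lt_one d).le).trans (hL d)
    have h2 : |a d - errRate a| ≤ 1 := abs_le.2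
      ⟨by linarith [h.pos d, errRate_le_one h], by linarith [h.lt_one d, errRate_nonneg h]⟩
    exact (abs_add_le _ _).trans (add_le_add h1 h2)
  cases b
  · exact key d
  · have := congrFun (corrErr_not h false) d
    simp only [Bool.not_false, Pi.smul_apply, smul_eq_mul, neg_one_mul] at this
    rw [this, abs_neg]
    exact key d

/-- The partial sums of the corrected errors along the bit sequence `u`. -/
def corrSum (a : ℤ → ℝ) (K : ℕ) (u : ℕ → Bool) : ℝ :=
  ∑ k ∈ Finset.range K, quenched a u k (corrErr a (u k))

/-- The centred error sum is the sum of the corrected errors up to a boundary term. -/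
lemma sum_errProb_sub (a : ℤ → ℝ) (K : ℕ) (u : ℕ → Bool) :
    ∑ k ∈ Finset.range K, (quenched a u k (errProb a (u k)) - errRate a)
      = corrSum a K u - quenched a u K (poissonSol a) := by
  induction K with
  | zero => simp [corrSum, quenched, poissonSol_zero]
  | succ K ih =>
    rw [Finset.sum_range_succ, ih, corrSum, corrSum, Finset.sum_range_succ, corrErr, quenched_add,
      quenched_sub, quenched_sub, quenched_const, quenched]
    ring

lemma measurable_corrSum (a : ℤ → ℝ) (K : ℕ) : Measurable (corrSum a K) :=
  Finset.measurable_sum _ fun k _ =>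
    measurable_quenched_bit a k (corrErr a) fun _ => measurable_quenched a k _

lemma abs_corrSum_le {a : ℤ → ℝ} (h : IsCrossing a) {L : ℝ} (hL : ∀ d, |poissonStep a d| ≤ L)
    (K : ℕ) (u : ℕ → Bool) : |corrSum a K u| ≤ K * (L + 1) := by
  refine (Finset.abs_sum_le_sum_abs _ _).trans ?_
  refine (Finset.sum_le_card_nsmul _ _ (L + 1) fun k _ =>
    abs_quenched_le h u k (abs_corrErr_le h hL (u k))).trans (le_of_eq ?_)
  simp
  ring

/-- The corrected errors are orthogonal: inverting the bit `K` changes the sign of the corrected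
error at time `K` and leaves the earlier ones unchanged. -/
lemma integral_corrSum_sq_le {a : ℤ → ℝ} (h : IsCrossing a) {L : ℝ}
    (hL : ∀ d, |poissonStep a d| ≤ L) (K : ℕ) :
    ∫ u, corrSum a K u ^ 2 ∂bernoulliMeasure ≤ (L + 1) ^ 2 * K := by
  induction K with
  | zero => simp [corrSum]
  | succ K ih =>
    set W : (ℕ → Bool) → ℝ := fun u => quenched a u K (corrErr a (u K)) with hWdef
    have hWm : Measurable W :=
      measurable_quenched_bit a K (corrErr a) fun b => measurable_quenched a K _
    have hW (u) : |W u| ≤ L + 1 := abs_quenched_le h u K (abs_corrErr_le h hL (u K))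
    have hS (u) : |corrSum a K u| ≤ K * (L + 1) := abs_corrSum_le h hL K u
    have hSm := measurable_corrSum a K
    have hL1 : 0 ≤ L + 1 := (abs_nonneg _).trans (hW fun _ => false)
    have hSi : Integrable (fun u => corrSum a K u ^ 2) bernoulliMeasure :=
      integrable_of_abs_le (hSm.pow_const 2) (C := (K * (L + 1)) ^ 2) fun u => by
        rw [abs_pow]
        exact pow_le_pow_left₀ (abs_nonneg _) (hS u) 2
    have hWi : Integrable (fun u => W u ^ 2) bernoulliMeasure :=
      integrable_of_abs_le (hWm.pow_const 2) (C := (L + 1) ^ 2) fun u => by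
        rw [abs_pow]
        exact pow_le_pow_left₀ (abs_nonneg _) (hW u) 2
    have hSWi : Integrable (fun u => corrSum a K u * W u) bernoulliMeasure :=
      integrable_of_abs_le (hSm.mul hWm) (C := (K * (L + 1)) * (L + 1)) fun u => by
        rw [abs_mul]
        exact mul_le_mul (hS u) (hW u) (abs_nonneg _) (by positivity)
    have hflip (u) : corrSum a K (flipBit K u) * W (flipBit K u) = -(corrSum a K u * W u) := by
      have h1 : corrSum a K (flipBit K u) = corrSum a K u :=
        Finset.sum_congr rfl fun k hk => by
          have hk' := Finset.mem_range.1 hk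
          rw [quenched_flipBit a u hk'.le, flipBit, if_neg (by omega)]
      have h2 : W (flipBit K u) = -W u := by
        simp only [hWdef]
        rw [quenched_flipBit a u le_rfl, flipBit, if_pos rfl, corrErr_not h, quenched_smul,
          neg_one_mul]
      rw [h1, h2, mul_neg]
    have horth : ∫ u, corrSum a K u * W u ∂bernoulliMeasure = 0 := by
      have := integral_comp_flipBit K (hSm.mul hWm)
      simp only [Pi.mul_apply, hflip, integral_neg] at this
      linarith
    have hW2 : ∫ u, W u ^ 2 ∂bernoulliMeasure ≤ (L + 1) ^ 2 := by
      have := integral_mono hWi (integrable_const ((L + 1) ^ 2)) fun u =>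
        sq_le_sq' (by linarith [(abs_le.1 (hW u)).1]) (abs_le.1 (hW u)).2
      simpa using this
    have hexp (u) : corrSum a (K + 1) u ^ 2
        = corrSum a K u ^ 2 + 2 * (corrSum a K u * W u) + W u ^ 2 := by
      rw [corrSum, Finset.sum_range_succ, ← corrSum]
      ring
    simp_rw [hexp]
    have e1 := integral_add (hSi.add (hSWi.const_mul 2)) hWi
    have e2 := integral_add hSi (hSWi.const_mul 2)
    simp only [Pi.add_apply] at e1
    rw [e1, e2, integral_const_mul, horth]
    push_cast
    linarith

lemma abs_errProb_le {a : ℤ → ℝ} (h : IsCrossing a) (b : Bool) (d : ℤ) : |errProb a b d| ≤ 1 := by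
  cases b <;> rw [errProb, abs_le]
  · exact ⟨by linarith [h.pos d], (h.lt_one d).le⟩
  · exact ⟨by linarith [h.lt_one (d - 1)], by linarith [h.pos (d - 1)]⟩

lemma measurable_quenched_errProb (a : ℤ → ℝ) (k : ℕ) :
    Measurable fun u : ℕ → Bool => quenched a u k (errProb a (u k)) :=
  measurable_quenched_bit a k (errProb a) fun _ => measurable_quenched a k _

lemma abs_mean_quenched_errProb_le {a : ℤ → ℝ} (h : IsCrossing a) (u : ℕ → Bool) (K : ℕ) :
    |1 / (K : ℝ) * ∑ k ∈ Finset.range K, quenched a u k (errProb a (u k))| ≤ 1 := by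
  have h1 : |∑ k ∈ Finset.range K, quenched a u k (errProb a (u k))| ≤ K := by
    refine (Finset.abs_sum_le_sum_abs _ _).trans ?_
    exact (Finset.sum_le_card_nsmul _ _ 1 fun k _ =>
      abs_quenched_le h u k (abs_errProb_le h (u k))).trans (le_of_eq (by simp))
  rw [abs_mul, abs_of_nonneg (by positivity : (0 : ℝ) ≤ 1 / K), one_div_mul_eq_div]
  exact div_le_one_of_le₀ h1 (Nat.cast_nonneg K)

/-- The ergodic theorem for the quenched error probabilities. -/
theorem ae_tendsto_quenched_errProb {a : ℤ → ℝ} (h : IsCrossing a) :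
    ∀ᵐ u ∂bernoulliMeasure, Tendsto
      (fun K : ℕ => 1 / (K : ℝ) * ∑ k ∈ Finset.range K, quenched a u k (errProb a (u k)))
      atTop (𝓝 (errRate a)) := by
  obtain ⟨L, hL⟩ : ∃ L, ∀ d, |poissonStep a d| ≤ L := ⟨_, abs_poissonStep_le h⟩
  have hL0 : 0 ≤ L := (abs_nonneg _).trans (hL 0)
  set R : ℕ → (ℕ → Bool) → ℝ := fun K u =>
    ∑ k ∈ Finset.range K, (quenched a u k (errProb a (u k)) - errRate a) with hRdef
  have hinc (k : ℕ) (u : ℕ → Bool) : |quenched a u k (errProb a (u k)) - errRate a| ≤ 2 := by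
    have h1 := abs_quenched_le h u k (abs_errProb_le h (u k))
    have h2 := errRate_nonneg h
    have h3 := errRate_le_one h
    rw [abs_le] at *
    constructor <;> linarith
  have hRm (K : ℕ) : Measurable (R K) := Finset.measurable_sum _ fun k _ =>
    (measurable_quenched_errProb a k).sub_const _
  have hRb (K : ℕ) (u : ℕ → Bool) : |R K u| ≤ K * 2 := by
    refine (Finset.abs_sum_le_sum_abs _ _).trans ?_
    exact (Finset.sum_le_card_nsmul _ _ 2 fun k _ => hinc k u).trans (le_of_eq (by simp))
  have hG (K : ℕ) (u : ℕ → Bool) : quenched a u K (poissonSol a) ^ 2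
      ≤ L ^ 2 * quenched a u K (fun d => (d : ℝ) ^ 2) := by
    rw [← quenched_smul]
    refine (quenched_sq_le h u K _).trans (quenched_mono h u K fun d => ?_)
    have := pow_le_pow_left₀ (abs_nonneg _) (abs_poissonSol_le hL d) 2
    simpa [mul_pow] using this
  have hSi (K : ℕ) : Integrable (fun u => corrSum a K u ^ 2) bernoulliMeasure :=
    integrable_of_abs_le ((measurable_corrSum a K).pow_const 2) (C := (K * (L + 1)) ^ 2)
      fun u => by
        rw [abs_pow]
        exact pow_le_pow_left₀ (abs_nonneg _) (abs_corrSum_le h hL K u) 2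
  have hRi (K : ℕ) : Integrable (fun u => R K u ^ 2) bernoulliMeasure :=
    integrable_of_abs_le ((hRm K).pow_const 2) (C := (K * 2) ^ 2) fun u => by
      rw [abs_pow]
      exact pow_le_pow_left₀ (abs_nonneg _) (hRb K u) 2
  have hmain : ∀ᵐ u ∂bernoulliMeasure, Tendsto (fun K : ℕ => R K u / K) atTop (𝓝 0) := by
    refine ae_tendsto_div_of_integral_sq_le (A := 2 * (L + 1) ^ 2 + 2 * L ^ 2) (B := 2) hRi
      (fun K => ?_) fun K u => ?_
    · have h1 (u : ℕ → Bool) : R K u ^ 2 ≤ 2 * corrSum a K u ^ 2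
          + 2 * L ^ 2 * quenched a u K (fun d => (d : ℝ) ^ 2) := by
        simp only [hRdef]
        rw [sum_errProb_sub]
        nlinarith [hG K u, sq_nonneg (corrSum a K u + quenched a u K (poissonSol a))]
      have hi := integrable_quenched a K (fun d => (d : ℝ) ^ 2)
      have h2 := integral_mono (hRi K)
        (((hSi K).const_mul 2).add (hi.const_mul (2 * L ^ 2))) h1
      simp only [Pi.add_apply] at h2
      rw [integral_add ((hSi K).const_mul 2) (hi.const_mul (2 * L ^ 2)), integral_const_mul,
        integral_const_mul] at h2
      have h3 := integral_corrSum_sq_le h hL K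
      have h4 := mul_le_mul_of_nonneg_left (integral_quenched_sq_le h K)
        (by positivity : 0 ≤ 2 * L ^ 2)
      linarith
    · simp only [hRdef]
      rw [Finset.sum_range_succ, add_sub_cancel_left]
      exact hinc K u
  filter_upwards [hmain] with u hu
  have h1 := hu.add_const (errRate a)
  rw [zero_add] at h1
  refine h1.congr' ?_
  filter_upwards [eventually_ge_atTop 1] with K hK
  have hK' : (K : ℝ) ≠ 0 := by positivity
  simp only [hRdef, Finset.sum_sub_distrib, Finset.sum_const, Finset.card_range, nsmul_eq_mul]
  field_simp
  ring

/-! ### The decoder as a function of the difference -/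

lemma bitDecision_eq {σ : ℝ≥0} (hσ : 0 < σ) (i : ℕ) (y : ℝ) :
    bitDecision σ i y = decide ((i : ℝ) + 1 / 2 < y) := by
  have hσ' : (0 : ℝ) < σ := by exact_mod_cast hσ
  have hC : 0 < (Real.sqrt (2 * Real.pi * ((σ ^ 2 : ℝ≥0) : ℝ)))⁻¹ := by
    push_cast
    positivity
  have key : Gam σ y i i ≥ Gam σ y i (i + 1) ↔ ¬ ((i : ℝ) + 1 / 2 < y) := by
    rw [Gam, Gam, if_pos (Or.inl rfl), if_pos (Or.inr rfl), ge_iff_le,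
      mul_le_mul_iff_left₀ (by norm_num), gaussianPDFReal, gaussianPDFReal,
      mul_le_mul_iff_right₀ hC, Real.exp_le_exp,
      div_le_div_iff_of_pos_right (by push_cast; positivity), neg_le_neg_iff, not_lt]
    push_cast
    constructor <;> intro h <;> nlinarith
  rw [bitDecision]
  by_cases h : (i : ℝ) + 1 / 2 < y
  · rw [if_neg (by rwa [key, not_not]), decide_eq_true h]
  · rw [if_pos (key.2 h), decide_eq_false h]

/-- The difference `x̂_k - x_k` between the estimated and the actual state, for the bits `u` and
the noise `n`. -/
def diffState (σ : ℝ≥0) (u : ℕ → Bool) (n : ℕ → ℝ) (k : ℕ) : ℤ :=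
  (estState σ (received u n) k : ℤ) - (state u k : ℤ)

/-- The noise level above which the decoder decides for the bit `1`, when the difference is `d`
and the transmitted bit is `b`. -/
def threshold (b : Bool) (d : ℤ) : ℝ := (d : ℝ) - b.toNat + 1 / 2

/-- The next difference, given the transmitted bit, the present difference and the noise. -/
def nextDiff (b : Bool) (d : ℤ) (x : ℝ) : ℤ :=
  d + (decide (threshold b d < x)).toNat - b.toNat

lemma decoder_eq {σ : ℝ≥0} (hσ : 0 < σ) (u : ℕ → Bool) (n : ℕ → ℝ) (k : ℕ) :
    decoder σ (received u n) k = decide (threshold (u k) (diffState σ u n k) < n k) := by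
  rw [decoder, bitDecision_eq hσ]
  congr 1
  rw [threshold, diffState, received, state]
  push_cast
  exact propext ⟨fun h => by linarith, fun h => by linarith⟩

lemma diffState_succ {σ : ℝ≥0} (hσ : 0 < σ) (u : ℕ → Bool) (n : ℕ → ℝ) (k : ℕ) :
    diffState σ u n (k + 1) = nextDiff (u k) (diffState σ u n k) (n k) := by
  rw [nextDiff, ← decoder_eq hσ, decoder, diffState, diffState, estState, state]
  push_cast
  ring

lemma diffState_congr {σ : ℝ≥0} (hσ : 0 < σ) {u v : ℕ → Bool} {n m : ℕ → ℝ} {k : ℕ}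
    (huv : ∀ j < k, u j = v j) (hnm : ∀ j < k, n j = m j) :
    diffState σ u n k = diffState σ v m k := by
  induction k with
  | zero => rfl
  | succ k ih =>
    rw [diffState_succ hσ, diffState_succ hσ, huv k k.lt_succ_self, hnm k k.lt_succ_self,
      ih (fun j hj => huv j (by omega)) fun j hj => hnm j (by omega)]

lemma decoder_congr {σ : ℝ≥0} (hσ : 0 < σ) {u v : ℕ → Bool} (n : ℕ → ℝ) {k : ℕ}
    (huv : ∀ j ≤ k, u j = v j) :
    decoder σ (received u n) k = decoder σ (received v n) k := by
  rw [decoder_eq hσ, decoder_eq hσ, huv k le_rfl,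
    diffState_congr hσ (fun j hj => huv j hj.le) fun _ _ => rfl]

lemma measurable_threshold_lt (b : Bool) :
    Measurable fun p : ℤ × ℝ => decide (threshold b p.1 < p.2) := by
  refine measurable_to_bool ?_
  have h : MeasurableSet {p : ℤ × ℝ | threshold b p.1 < p.2} :=
    measurableSet_lt ((measurable_from_top (f := threshold b)).comp measurable_fst) measurable_snd
  convert! h using 1
  ext p
  simp

lemma measurable_nextDiff (b : Bool) : Measurable fun p : ℤ × ℝ => nextDiff b p.1 p.2 := by
  have h := (measurable_of_finite fun c : Bool => (c.toNat : ℤ)).comp (measurable_threshold_lt b)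
  exact (measurable_fst.add h).sub_const _

lemma measurable_diffState {σ : ℝ≥0} (hσ : 0 < σ) (k : ℕ) :
    Measurable fun p : (ℕ → Bool) × (ℕ → ℝ) => diffState σ p.1 p.2 k := by
  induction k with
  | zero => simp [diffState, estState, state]
  | succ k ih =>
    simp_rw [diffState_succ hσ]
    have h : Measurable fun q : Bool × ℤ × ℝ => nextDiff q.1 q.2.1 q.2.2 :=
      measurable_from_prod_countable_right measurable_nextDiff
    exact h.comp (((measurable_pi_apply k).comp measurable_fst).prodMk
      (ih.prodMk ((measurable_pi_apply k).comp measurable_snd)))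

lemma measurable_decoder {σ : ℝ≥0} (hσ : 0 < σ) (k : ℕ) :
    Measurable fun p : (ℕ → Bool) × (ℕ → ℝ) => decoder σ (received p.1 p.2) k := by
  simp_rw [decoder_eq hσ]
  have h : Measurable fun q : Bool × ℤ × ℝ => decide (threshold q.1 q.2.1 < q.2.2) :=
    measurable_from_prod_countable_right measurable_threshold_lt
  exact h.comp (((measurable_pi_apply k).comp measurable_fst).prodMk
    ((measurable_diffState hσ k).prodMk ((measurable_pi_apply k).comp measurable_snd)))

/-! ### Error probabilities for fixed bits -/

/-- The pairs of a bit sequence and a noise sequence for which the bit `k` is decoded wrongly. -/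
def errPairs (σ : ℝ≥0) (k : ℕ) : Set ((ℕ → Bool) × (ℕ → ℝ)) :=
  {p | decoder σ (received p.1 p.2) k ≠ p.1 k}

lemma measurableSet_errPairs {σ : ℝ≥0} (hσ : 0 < σ) (k : ℕ) : MeasurableSet (errPairs σ k) :=
  (measurableSet_eq_fun (measurable_decoder hσ k)
    ((measurable_pi_apply k).comp measurable_fst)).compl

lemma gaussianReal_threshold (σ : ℝ≥0) (b : Bool) (d : ℤ) :
    (gaussianReal 0 (σ ^ 2)).real (Set.Ioi (threshold b d))
      = match b with
        | false => tail σ d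
        | true => tail σ (d - 1) := by
  cases b
  · simp [threshold, tail]
  · simp only [threshold, tail]
    congr 2
    push_cast [Bool.toNat_true]
    ring

lemma integral_ite_lt {μ : Measure ℝ} [IsProbabilityMeasure μ] (t A B : ℝ) :
    ∫ x, (if t < x then A else B) ∂μ = μ.real (Set.Ioi t) * A + (1 - μ.real (Set.Ioi t)) * B := by
  have h1 (x : ℝ) : (if t < x then A else B) = (Set.Ioi t).indicator (fun _ => A - B) x + B := by
    by_cases h : t < x <;> simp [h]
  simp_rw [h1]
  rw [integral_add ((integrable_const _).indicator measurableSet_Ioi) (integrable_const _),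
    integral_indicator measurableSet_Ioi]
  simp
  ring

lemma integral_nextDiff (σ : ℝ≥0) (b : Bool) (f : ℤ → ℝ) (d : ℤ) :
    ∫ x, f (nextDiff b d x) ∂gaussianReal 0 (σ ^ 2) = stepOp (tail σ) b f d := by
  have h1 (x : ℝ) : f (nextDiff b d x)
      = if threshold b d < x then f (d + 1 - b.toNat) else f (d - b.toNat) := by
    by_cases h : threshold b d < x <;> simp [nextDiff, h]
  simp_rw [h1]
  rw [integral_ite_lt, gaussianReal_threshold]
  cases b <;> simp [stepOp]

lemma integral_ne_bit (σ : ℝ≥0) (b : Bool) (d : ℤ) :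
    ∫ x, (if decide (threshold b d < x) ≠ b then (1 : ℝ) else 0) ∂gaussianReal 0 (σ ^ 2)
      = errProb (tail σ) b d := by
  have h1 (x : ℝ) : (if decide (threshold b d < x) ≠ b then (1 : ℝ) else 0)
      = if threshold b d < x then (if b then 0 else 1) else (if b then 1 else 0) := by
    by_cases h : threshold b d < x <;> cases b <;> simp [h]
  simp_rw [h1]
  rw [integral_ite_lt, gaussianReal_threshold]
  cases b <;> simp [errProb]

lemma measurable_diffState_noise {Ω : Type*} [MeasurableSpace Ω] {σ : ℝ≥0} {N : ℕ → Ω → ℝ}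
    (hσ : 0 < σ) (hNm : ∀ k, Measurable (N k)) (u : ℕ → Bool) (k : ℕ) :
    Measurable fun ω => diffState σ u (fun j => N j ω) k := by
  have h : Measurable fun ω => (u, fun j => N j ω) :=
    measurable_const.prodMk (measurable_pi_lambda _ hNm)
  have := Measurable.comp (measurable_diffState hσ k) h
  exact this

/-- The difference at time `k` involves the noise variables of index `j < k` only. -/
lemma indepFun_diffState {Ω : Type*} [MeasurableSpace Ω] {P : Measure Ω} {σ : ℝ≥0}
    {N : ℕ → Ω → ℝ} (hσ : 0 < σ) (hNm : ∀ k, Measurable (N k)) (hNind : iIndepFun N P)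
    (u : ℕ → Bool) (k : ℕ) :
    IndepFun (fun ω => diffState σ u (fun j => N j ω) k) (N k) P := by
  have h := hNind.indepFun_finset (Finset.range k) {k} (by simp) hNm
  let φ : (Finset.range k → ℝ) → ℤ := fun t =>
    diffState σ u (fun j => if hj : j ∈ Finset.range k then t ⟨j, hj⟩ else 0) k
  have hφ : Measurable φ := by
    have h1 : Measurable fun (t : Finset.range k → ℝ) (j : ℕ) =>
        if hj : j ∈ Finset.range k then t ⟨j, hj⟩ else 0 := by
      refine measurable_pi_lambda _ fun j => ?_
      split_ifs with hj
      · exact measurable_pi_apply _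
      · exact measurable_const
    have := Measurable.comp (measurable_diffState hσ k) ((measurable_const (a := u)).prodMk h1)
    exact this
  have h2 := h.comp hφ (measurable_pi_apply (⟨k, Finset.mem_singleton_self k⟩ : ({k} : Finset ℕ)))
  convert! h2 using 1
  ext ω
  exact diffState_congr hσ (fun _ _ => rfl) fun j hj => by simp [hj]

section Law

variable {Ω : Type*} [MeasurableSpace Ω] {P : Measure Ω} [IsProbabilityMeasure P] {σ : ℝ≥0}
  {N : ℕ → Ω → ℝ}

/-- Integration over the noise at time `k` first, for the fixed difference at time `k`. -/
lemma integral_diffState_noise (hσ : 0 < σ) (hNm : ∀ k, Measurable (N k))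
    (hNlaw : ∀ k, P.map (N k) = gaussianReal 0 (σ ^ 2)) (hNind : iIndepFun N P)
    (u : ℕ → Bool) (k : ℕ) {F : ℤ × ℝ → ℝ} (hF : Measurable F) {C : ℝ} (hC : ∀ p, |F p| ≤ C) :
    ∫ ω, F (diffState σ u (fun j => N j ω) k, N k ω) ∂P
      = ∫ ω, (∫ x, F (diffState σ u (fun j => N j ω) k, x) ∂gaussianReal 0 (σ ^ 2)) ∂P := by
  have hX := measurable_diffState_noise hσ hNm u k
  have hlaw := (indepFun_iff_map_prod_eq_prod_map_map hX.aemeasurable (hNm k).aemeasurable).1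
    (indepFun_diffState hσ hNm hNind u k)
  have := Measure.isProbabilityMeasure_map (μ := P) hX.aemeasurable
  rw [← integral_map (φ := fun ω => (diffState σ u (fun j => N j ω) k, N k ω))
    (hX.prodMk (hNm k)).aemeasurable hF.aestronglyMeasurable, hlaw, hNlaw, integral_prod]
  · exact integral_map (f := fun d => ∫ x, F (d, x) ∂gaussianReal 0 (σ ^ 2)) hX.aemeasurable
      (measurable_from_top.aestronglyMeasurable)
  · exact Integrable.of_bound hF.aestronglyMeasurable C (ae_of_all _ hC)

lemma integral_diffState (hσ : 0 < σ) (hNm : ∀ k, Measurable (N k))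
    (hNlaw : ∀ k, P.map (N k) = gaussianReal 0 (σ ^ 2)) (hNind : iIndepFun N P)
    (u : ℕ → Bool) (k : ℕ) {f : ℤ → ℝ} {C : ℝ} (hf : ∀ d, |f d| ≤ C) :
    ∫ ω, f (diffState σ u (fun j => N j ω) k) ∂P = quenched (tail σ) u k f := by
  induction k generalizing f with
  | zero => simp [diffState, estState, state, quenched]
  | succ k ih =>
    simp_rw [diffState_succ hσ]
    have h := integral_diffState_noise hσ hNm hNlaw hNind u k
      (F := fun p => f (nextDiff (u k) p.1 p.2))
      ((measurable_from_top (f := f)).comp (measurable_nextDiff (u k))) (C := C) fun p => hf _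
    simp only [integral_nextDiff] at h
    rw [h, quenched]
    exact ih (abs_stepOp_le (isCrossing_tail hσ) (u k) hf)

/-- For a fixed bit sequence, the probability over the noise of a wrong decision at time `k`. -/
lemma measureReal_errPairs (hσ : 0 < σ) (hNm : ∀ k, Measurable (N k))
    (hNlaw : ∀ k, P.map (N k) = gaussianReal 0 (σ ^ 2)) (hNind : iIndepFun N P)
    (u : ℕ → Bool) (k : ℕ) :
    P.real {ω | (u, fun j => N j ω) ∈ errPairs σ k}
      = quenched (tail σ) u k (errProb (tail σ) (u k)) := by
  have hm : MeasurableSet {ω | (u, fun j => N j ω) ∈ errPairs σ k} :=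
    (measurable_const.prodMk (measurable_pi_lambda _ hNm)) (measurableSet_errPairs hσ k)
  rw [← integral_indicator_one hm, ← integral_diffState hσ hNm hNlaw hNind u k
    (abs_errProb_le (isCrossing_tail hσ) (u k))]
  have h := integral_diffState_noise hσ hNm hNlaw hNind u k
    (F := fun p => if decide (threshold (u k) p.1 < p.2) ≠ u k then 1 else 0)
    (Measurable.ite (measurableSet_eq_fun (measurable_threshold_lt (u k)) measurable_const).compl
      measurable_const measurable_const) (C := 1) fun p => by split_ifs <;> simp
  simp only [integral_ne_bit] at h
  rw [← h]
  congr 1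
  ext ω
  simp only [Set.indicator_apply, Set.mem_ofPred_eq, errPairs, decoder_eq hσ, Pi.one_apply]

end Law

/-! ### Error rates for random bits -/

lemma fairBit_singleton_ne_zero (b : Bool) : fairBit {b} ≠ 0 := by
  rw [fairBit, PMF.toMeasure_apply_singleton _ _ (measurableSet_singleton b)]
  simp

lemma measure_cylinder_ne_zero {Ω : Type*} [MeasurableSpace Ω] {P : Measure Ω}
    {U : ℕ → Ω → Bool} (hUm : ∀ k, Measurable (U k)) (hUlaw : ∀ k, P.map (U k) = fairBit)
    (hUind : iIndepFun U P) (u : ℕ → Bool) (K : ℕ) :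
    P {ω | ∀ j < K, U j ω = u j} ≠ 0 := by
  have h := hUind.measure_inter_preimage_eq_mul (Finset.range K) (sets := fun j => {u j})
    fun j _ => measurableSet_singleton _
  have h1 : {ω | ∀ j < K, U j ω = u j} = ⋂ j ∈ Finset.range K, U j ⁻¹' {u j} := by
    ext ω
    simp
  rw [h1, h, Finset.prod_ne_zero_iff]
  intro j _
  rw [← Measure.map_apply (hUm j) (measurableSet_singleton _), hUlaw]
  exact fairBit_singleton_ne_zero _

section Rates

variable {Ω : Type*} [MeasurableSpace Ω] {P : Measure Ω} [IsProbabilityMeasure P] {σ : ℝ≥0}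
  {U : ℕ → Ω → Bool} {N : ℕ → Ω → ℝ}

/-- Conditioning on the bits amounts to fixing them, the noise being independent of them. -/
lemma cond_errorEvent (hσ : 0 < σ) (hUm : ∀ k, Measurable (U k)) (hNm : ∀ k, Measurable (N k))
    (hUlaw : ∀ k, P.map (U k) = fairBit)
    (hNlaw : ∀ k, P.map (N k) = gaussianReal 0 (σ ^ 2))
    (hUind : iIndepFun U P) (hNind : iIndepFun N P)
    (hUN : IndepFun (fun ω k => U k ω) (fun ω k => N k ω) P) (u : ℕ → Bool) {k K : ℕ}
    (hk : k < K) :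
    (ProbabilityTheory.cond P {ω | ∀ j < K, U j ω = u j}).real (errorEvent σ U N k)
      = quenched (tail σ) u k (errProb (tail σ) (u k)) := by
  set V : Set (ℕ → Bool) := {v | ∀ j < K, v j = u j} with hV
  have hVm : MeasurableSet V := by
    have : V = ⋂ j, ⋂ (_ : j < K), {v | v j = u j} := by
      ext v
      simp [hV]
    rw [this]
    exact .iInter fun j => .iInter fun _ =>
      measurableSet_eq_fun (measurable_pi_apply j) measurable_const
  set E : Set (ℕ → ℝ) := {n | (u, n) ∈ errPairs σ k} with hE
  have hEm : MeasurableSet E :=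
    (measurable_const.prodMk measurable_id) (measurableSet_errPairs hσ k)
  have hcyl : {ω | ∀ j < K, U j ω = u j} = (fun ω j => U j ω) ⁻¹' V := rfl
  have hinter : (fun ω j => U j ω) ⁻¹' V ∩ errorEvent σ U N k
      = (fun ω j => U j ω) ⁻¹' V ∩ (fun ω j => N j ω) ⁻¹' E := by
    ext ω
    simp only [Set.mem_inter_iff, and_congr_right_iff]
    intro hω
    have h1 : decoder σ (received (fun j => U j ω) fun j => N j ω) k
        = decoder σ (received u fun j => N j ω) k :=
      decoder_congr hσ _ fun j hj => hω j (by omega)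
    have h2 : U k ω = u k := hω k hk
    simp only [errorEvent, Set.mem_ofPred_eq, hE, Set.mem_preimage, errPairs, h1, h2]
  have hne := measure_cylinder_ne_zero hUm hUlaw hUind u K
  rw [← measureReal_errPairs hσ hNm hNlaw hNind u k, measureReal_def, measureReal_def]
  congr 1
  rw [hcyl] at hne ⊢
  rw [cond_apply (measurable_pi_lambda _ hUm hVm), hinter,
    hUN.measure_inter_preimage_eq_mul V E hVm hEm, ← mul_assoc,
    ENNReal.inv_mul_cancel hne (measure_ne_top _ _), one_mul]
  rfl

lemma CBER_eq (hσ : 0 < σ) (hUm : ∀ k, Measurable (U k)) (hNm : ∀ k, Measurable (N k))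
    (hUlaw : ∀ k, P.map (U k) = fairBit)
    (hNlaw : ∀ k, P.map (N k) = gaussianReal 0 (σ ^ 2))
    (hUind : iIndepFun U P) (hNind : iIndepFun N P)
    (hUN : IndepFun (fun ω k => U k ω) (fun ω k => N k ω) P) (u : ℕ → Bool) (K : ℕ) :
    CBER P σ U N u K
      = 1 / (K : ℝ) * ∑ k ∈ Finset.range K, quenched (tail σ) u k (errProb (tail σ) (u k)) := by
  rw [CBER]
  congr 1
  exact Finset.sum_congr rfl fun k hk =>
    cond_errorEvent hσ hUm hNm hUlaw hNlaw hUind hNind hUN u (Finset.mem_range.1 hk)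

lemma map_bits_eq_bernoulliMeasure (hUm : ∀ k, Measurable (U k))
    (hUlaw : ∀ k, P.map (U k) = fairBit) (hUind : iIndepFun U P) :
    P.map (fun ω k => U k ω) = bernoulliMeasure := by
  rw [(iIndepFun_iff_map_fun_eq_infinitePi_map hUm).1 hUind, bernoulliMeasure]
  simp_rw [hUlaw]

lemma measureReal_errorEvent (hσ : 0 < σ) (hUm : ∀ k, Measurable (U k))
    (hNm : ∀ k, Measurable (N k)) (hUlaw : ∀ k, P.map (U k) = fairBit)
    (hNlaw : ∀ k, P.map (N k) = gaussianReal 0 (σ ^ 2))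
    (hUind : iIndepFun U P) (hNind : iIndepFun N P)
    (hUN : IndepFun (fun ω k => U k ω) (fun ω k => N k ω) P) (k : ℕ) :
    P.real (errorEvent σ U N k)
      = ∫ u, quenched (tail σ) u k (errProb (tail σ) (u k)) ∂bernoulliMeasure := by
  have hU : Measurable fun ω k => U k ω := measurable_pi_lambda _ hUm
  have hN : Measurable fun ω k => N k ω := measurable_pi_lambda _ hNm
  have hlaw := (indepFun_iff_map_prod_eq_prod_map_map hU.aemeasurable hN.aemeasurable).1 hUN
  rw [map_bits_eq_bernoulliMeasure hUm hUlaw hUind] at hlaw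
  have := Measure.isProbabilityMeasure_map (μ := P) hN.aemeasurable
  have hE := measurableSet_errPairs hσ k
  have h1 : P (errorEvent σ U N k) = (P.map fun ω => ((fun k => U k ω), fun k => N k ω))
      (errPairs σ k) := (Measure.map_apply (hU.prodMk hN) hE).symm
  have h2 (u : ℕ → Bool) : (P.map fun ω k => N k ω) (Prod.mk u ⁻¹' errPairs σ k)
      = ENNReal.ofReal (quenched (tail σ) u k (errProb (tail σ) (u k))) := by
    rw [Measure.map_apply hN (measurable_prodMk_left hE),
      ← measureReal_errPairs hσ hNm hNlaw hNind u k, ofReal_measureReal]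
    rfl
  rw [measureReal_def, h1, hlaw, Measure.prod_apply hE]
  simp_rw [h2]
  rw [integral_eq_lintegral_of_nonneg_ae (ae_of_all _ fun u => ?_)
    (measurable_quenched_errProb _ k).aestronglyMeasurable]
  simp only [Pi.zero_apply]
  rw [← measureReal_errPairs hσ hNm hNlaw hNind u k]
  exact measureReal_nonneg

/-- The bit error rate is the mean over the bits of the conditional bit error rate. -/
lemma BER_eq_integral (hσ : 0 < σ) (hUm : ∀ k, Measurable (U k))
    (hNm : ∀ k, Measurable (N k)) (hUlaw : ∀ k, P.map (U k) = fairBit)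
    (hNlaw : ∀ k, P.map (N k) = gaussianReal 0 (σ ^ 2))
    (hUind : iIndepFun U P) (hNind : iIndepFun N P)
    (hUN : IndepFun (fun ω k => U k ω) (fun ω k => N k ω) P) (K : ℕ) :
    BER P σ U N K = ∫ u, 1 / (K : ℝ) * ∑ k ∈ Finset.range K,
      quenched (tail σ) u k (errProb (tail σ) (u k)) ∂bernoulliMeasure := by
  rw [BER, integral_const_mul, integral_finsetSum]
  · congr 1
    exact Finset.sum_congr rfl fun k _ =>
      measureReal_errorEvent hσ hUm hNm hUlaw hNlaw hUind hNind hUN k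
  · exact fun k _ => integrable_of_abs_le (measurable_quenched_errProb _ k) fun u =>
      abs_quenched_le (isCrossing_tail hσ) u k (abs_errProb_le (isCrossing_tail hσ) (u k))

end Rates

end OneState

end

theorem theorem1 {Ω : Type*} [MeasurableSpace Ω] (P : Measure Ω) [IsProbabilityMeasure P]
    (σ : ℝ≥0) (hσ : 0 < σ)
    (U : ℕ → Ω → Bool) (N : ℕ → Ω → ℝ)
    (hUm : ∀ k, Measurable (U k)) (hNm : ∀ k, Measurable (N k))
    (hUlaw : ∀ k, P.map (U k) = OneState.fairBit)
    (hNlaw : ∀ k, P.map (N k) = gaussianReal 0 (σ ^ 2))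
    (hUind : iIndepFun U P) (hNind : iIndepFun N P)
    (hUN : IndepFun (fun ω k => U k ω) (fun ω k => N k ω) P) :
    ∃ Φ : ℤ → ℝ,
      OneState.IsInvariantProb (OneState.avgTrans σ) Φ ∧
      (∀ Ψ : ℤ → ℝ, OneState.IsInvariantProb (OneState.avgTrans σ) Ψ → Ψ = Φ) ∧
      Summable (fun d => OneState.qbar σ d * Φ d) ∧
      Tendsto (fun K => OneState.BER P σ U N K) atTop (𝓝 (∑' d, OneState.qbar σ d * Φ d)) ∧
      ∀ᵐ u ∂OneState.bernoulliMeasure,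
        Tendsto (fun K => OneState.CBER P σ U N u K) atTop
          (𝓝 (∑' d, OneState.qbar σ d * Φ d)) := by
  have ha := OneState.isCrossing_tail hσ
  have hlim := OneState.ae_tendsto_quenched_errProb ha
  rw [OneState.avgTrans_eq hσ, OneState.qbar_eq hσ]
  refine ⟨OneState.stationary (OneState.tail σ), OneState.isInvariantProb_stationary ha,
    fun Ψ hΨ => OneState.eq_stationary_of_isInvariantProb ha hΨ,
    OneState.summable_meanErr_mul ha, ?_, ?_⟩
  · simp_rw [OneState.BER_eq_integral hσ hUm hNm hUlaw hNlaw hUind hNind hUN]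
    have := tendsto_integral_of_dominated_convergence (μ := OneState.bernoulliMeasure)
      (fun _ => (1 : ℝ))
      (fun K => ((Finset.measurable_sum (Finset.range K) fun k _ =>
        OneState.measurable_quenched_errProb (OneState.tail σ) k).const_mul
          (1 / (K : ℝ))).aestronglyMeasurable)
      (integrable_const 1)
      (fun K => ae_of_all _ fun u => OneState.abs_mean_quenched_errProb_le ha u K) hlim
    rwa [integral_const, probReal_univ, one_smul] at this
  · filter_upwards [hlim] with u hu
    simp_rw [OneState.CBER_eq hσ hUm hNm hUlaw hNlaw hUind hNind hUN]
    exact hu
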